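/- Let $PSL(2,\mathbb R)=SL(2,\mathbb R)/\{\pm I\}$ carry its usual Lie group topology, and let it act by Möbius transformations on the hyperbolic plane $\mathbb H^2$ and on its circle at infinity $\partial\mathbb H^2=\mathbb P^1(\mathbb R)$. Call a subgroup of $PSL(2,\mathbb R)$ elementary if it fixes a point of $\mathbb H^2$, or fixes a point of $\partial\mathbb H^2$, or preserves a geodesic of $\mathbb H^2$ (possibly exchanging its two endpoints). An element of $PSL(2,\mathbb R)$ is elliptic if it is represented by a matrix of determinant $1$ whose trace has absolute value less than $2$. **Proposition.** Let $H$ be a finitely generated subgroup of $PSL(2,\mathbb R)$ that is not elementary and not discrete. Then there are an elliptic element $\alpha\in H$ of infinite order and a conjugate $\beta=h\alpha h^{-1}$ of $\alpha$ by an element $h\in H$ such that, for every neighbourhood $U$ of the identity in $PSL(2,\mathbb R)$, there are integers $p,q\ge 1$ for which $a=\alpha^{p}$ and $b=\beta^{q}$ both lie in $U$ and freely generate a free group of rank two. (In particular, for every left-invariant metric $\rho$ inducing the topology of $PSL(2,\mathbb R)$ and every $\varepsilon>0$, one can achieve $\rho(a,1)<\varepsilon$ and $\rho(b,1)<\varepsilon$.)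 -/

import Mathlib

open scoped MatrixGroups LinearAlgebra.Projectivization Topology

/-- The isometric Möbius action of `PSL(2, ℝ)` on the upper half-plane, induced from the action
of `SL(2, ℝ)`, as a homomorphism to permutations. -/
noncomputable def pslToPermUpperHalfPlane : PSL(2, ℝ) →* Equiv.Perm UpperHalfPlane :=
  QuotientGroup.lift (Subgroup.center SL(2, ℝ)) (MulAction.toPermHom SL(2, ℝ) UpperHalfPlane) <| by
    intro g hg
    rw [Matrix.SpecialLinearGroup.mem_center_iff] at hg
    obtain ⟨r, hr, hg⟩ := hg
    have hr2 : r ^ 2 = 1 := by simpa using hr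
    have hr0 : (r : ℂ) ≠ 0 := by
      rintro h
      have : r = 0 := by exact_mod_cast h
      simp [this] at hr2
    rw [MonoidHom.mem_ker]
    ext z
    have h00 : g 0 0 = r := by rw [← hg]; simp
    have h01 : g 0 1 = 0 := by rw [← hg]; simp
    have h10 : g 1 0 = 0 := by rw [← hg]; simp
    have h11 : g 1 1 = r := by rw [← hg]; simp
    simp [UpperHalfPlane.coe_specialLinearGroup_apply, h00, h01, h10, h11, hr0]

/-- `PSL(2, ℝ)` acts on the hyperbolic plane (upper half-plane model) by Möbius transformations. -/
noncomputable instance pslMulActionUpperHalfPlane : MulAction PSL(2, ℝ) UpperHalfPlane :=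
  MulAction.compHom UpperHalfPlane pslToPermUpperHalfPlane

theorem psl_mk_smul_upperHalfPlane (g : SL(2, ℝ)) (z : UpperHalfPlane) :
    (g : PSL(2, ℝ)) • z = g • z := rfl

/-- A subgroup of `PSL(2, ℝ)` is elementary if it fixes a point of the hyperbolic plane, fixes a
point of the circle at infinity (identified with the real projective line), or preserves a geodesic
of the hyperbolic plane. A geodesic is given by its two distinct endpoints `x`, `y` at infinity, and
it is preserved by `g` exactly when `g` preserves the unordered pair of its endpoints. -/
def IsElementarySubgroup (H : Subgroup PSL(2, ℝ)) : Prop :=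
  (∃ z : UpperHalfPlane, ∀ g ∈ H, g • z = z) ∨
  (∃ x : ℙ ℝ (Fin 2 → ℝ), ∀ g ∈ H, g • x = x) ∨
  (∃ x y : ℙ ℝ (Fin 2 → ℝ), x ≠ y ∧ ∀ g ∈ H, ({g • x, g • y} : Set (ℙ ℝ (Fin 2 → ℝ))) = {x, y})

/-- An element of `PSL(2, ℝ)` is elliptic if it is represented by a matrix of determinant one with
negative discriminant, that is, with trace of absolute value less than two. -/
def IsEllipticPSL (p : PSL(2, ℝ)) : Prop :=
  ∃ g : SL(2, ℝ), (g : PSL(2, ℝ)) = p ∧ (g : Matrix (Fin 2) (Fin 2) ℝ).IsElliptic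

/-- The pair `a`, `b` freely generates a free group of rank two: the canonical homomorphism from
the free group on two letters, sending the letters to `a` and `b`, is injective. -/
def FreelyGenerate {G : Type*} [Group G] (a b : G) : Prop :=
  Function.Injective (FreeGroup.lift (![a, b] : Fin 2 → G))

/-! There are two independent halves: finding an elliptic element of infinite order, and playing
ping-pong with its powers over a field other than `ℝ`.

For the first, suppose every elliptic element of `H` has finite order. Its trace is then `ζ + ζ⁻¹`
for a root of unity `ζ`, and lies in a fixed finitely generated field. Such a field contains only
finitely many of these numbers: its algebraic elements have bounded degree, and these are algebraic
integers with all conjugates of absolute value at most 2. Hence elements of the preimage of `H` near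
the identity have trace at least 2. Rescaling their traceless parts gives, since `H` is not
discrete, nonzero limit directions in the traceless matrices. Trace identities for products and
commutators force a direction and each of its conjugates to have a degenerate Gram matrix for the
trace form, so `H` fixes a point at infinity or preserves a geodesic, a contradiction.

For the second, powers of the elliptic `α` return to every neighbourhood of the identity, but over
`ℝ` or `ℂ` its eigenvalues have absolute value 1 and produce no contraction. By Tits' lemma
(`exists_ringHom_norm_ne_one`) some embedding of `ℂ` into a normed field moves an eigenvalue off the
unit circle. If `h` moves the fixed point of `α` in the upper half-plane, then `α` and `hαh⁻¹` have
four distinct complex eigenlines, and after the embedding all sufficiently high powers play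
ping-pong (`eventually_injective_lift_pow`). Freeness is purely algebraic, so it transfers back; the
high powers can be chosen close to the identity. -/

/-! ### Extending embeddings between algebraically closed fields -/

section FieldIsomorphisms

open Cardinal

/-- Two algebraically closed uncountable fields of the same cardinality that contain a countable
domain `R` are isomorphic over `R`. -/
theorem IsAlgClosed.exists_ringEquiv_of_countable {R K L : Type} [CommRing R] [IsDomain R]
    [Countable R] [Field K] [Field L] [IsAlgClosed K] [IsAlgClosed L]
    (f : R →+* K) (g : R →+* L) (hf : Function.Injective f) (hg : Function.Injective g)
    (hK : ℵ₀ < #K) (hKL : #K = #L) : ∃ e : K ≃+* L, ∀ r, e (f r) = g r := by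
  let := f.toAlgebra
  let := g.toAlgebra
  have : FaithfulSMul R K := (faithfulSMul_iff_algebraMap_injective R K).2 hf
  have : FaithfulSMul R L := (faithfulSMul_iff_algebraMap_injective R L).2 hg
  obtain ⟨s, hs⟩ := exists_isTranscendenceBasis R K
  obtain ⟨t, ht⟩ := exists_isTranscendenceBasis R L
  -- Over a countable domain, an uncountable algebraically closed field has the cardinality of any
  -- of its transcendence bases.
  have hst : #s = #t := by
    rw [← cardinal_eq_cardinal_transcendence_basis_of_aleph0_lt' _ hs (mk_le_aleph0) hK,
      ← cardinal_eq_cardinal_transcendence_basis_of_aleph0_lt' _ ht (mk_le_aleph0) (hKL ▸ hK), hKL]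
  obtain ⟨e⟩ := Cardinal.eq.1 hst
  let := isAlgClosure_of_transcendence_basis _ hs
  let := isAlgClosure_of_transcendence_basis _ ht
  let e' := (hs.1.aevalEquiv.symm.trans (MvPolynomial.renameEquiv R e)).trans ht.1.aevalEquiv
  refine ⟨IsAlgClosure.equivOfEquiv K L e'.toRingEquiv, fun r => ?_⟩
  have := IsAlgClosure.equivOfEquiv_algebraMap K L e'.toRingEquiv (algebraMap R _ r)
  rw [← IsScalarTower.algebraMap_apply] at this
  refine this.trans ?_
  have h2 : e'.toRingEquiv (algebraMap R _ r) = algebraMap R _ r := e'.commutes r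
  rw [h2, ← IsScalarTower.algebraMap_apply]
  rfl

/-- An algebraic number can be moved to any of its conjugates by an isomorphism between
algebraically closed fields of the same uncountable cardinality. -/
theorem IsAlgClosed.exists_ringEquiv_of_aeval_minpoly {K L : Type} [Field K] [Field L]
    [IsAlgClosed K] [IsAlgClosed L] [CharZero K] [CharZero L] (hK : ℵ₀ < #K) (hKL : #K = #L)
    {a : K} {b : L} (ha : IsAlgebraic ℚ a) (hb : Polynomial.aeval b (minpoly ℚ a) = 0) :
    ∃ e : K ≃+* L, e a = b := by
  -- The algebraic numbers in `K` form a countable field, so an embedding of it into `L` taking `a`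
  -- to `b` extends to an isomorphism.
  let F := algebraicClosure ℚ K
  have : Algebra.IsAlgebraic ℚ F := algebraicClosure.isAlgebraic ℚ K
  have hcF : Countable F := by
    have h := Algebra.IsAlgebraic.cardinalMk_le_max ℚ F
    rw [← Cardinal.mk_le_aleph0_iff]
    simpa using h
  let a' : F := ⟨a, mem_algebraicClosure_iff.2 ha⟩
  have hmin : minpoly ℚ a' = minpoly ℚ a := by
    rw [← minpoly.algebraMap_eq (B' := K) (algebraMap F K).injective]
    rfl
  obtain ⟨φ, hφ⟩ := (IntermediateField.exists_algHom_of_splits_of_aeval (F := ℚ) (E := F) (K := L)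
    (x := a') (y := b) (fun s => ⟨(Algebra.IsAlgebraic.isAlgebraic s).isIntegral,
      IsAlgClosed.splits _⟩) (by rw [hmin]; exact hb))
  obtain ⟨e, he⟩ := exists_ringEquiv_of_countable (algebraMap F K) φ.toRingHom
    (algebraMap F K).injective φ.injective hK hKL
  exact ⟨e, (he a').trans hφ⟩

theorem Padic.cardinalMk (p : ℕ) [Fact p.Prime] : #ℚ_[p] = 𝔠 := by
  refine le_antisymm ?_ (continuum_le_cardinal_of_nontriviallyNormedField ℚ_[p])
  have h1 : #ℚ_[p] ≤ #(PadicSeq p) := Cardinal.mk_quotient_le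
  have h2 : #(PadicSeq p) ≤ #(ℕ → ℚ) := Cardinal.mk_subtype_le _
  refine (h1.trans h2).trans ?_
  simp

theorem PadicAlgCl.cardinalMk (p : ℕ) [Fact p.Prime] : #(PadicAlgCl p) = 𝔠 := by
  have h1 := Algebra.IsAlgebraic.cardinalMk_le_max ℚ_[p] (PadicAlgCl p)
  rw [Padic.cardinalMk, max_eq_left aleph0_le_continuum] at h1
  refine le_antisymm h1 ?_
  rw [← Padic.cardinalMk p]
  exact Cardinal.mk_le_of_injective (algebraMap ℚ_[p] (PadicAlgCl p)).injective

end FieldIsomorphisms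

/-! ### Tits' lemma on absolute values -/

section AbsoluteValues

open Polynomial Cardinal

/-- If all conjugates of an algebraic number in `PadicAlgCl p` have norm at most one, then the
coefficients of its minimal polynomial are `p`-integral. -/
theorem PadicAlgCl.norm_coeff_minpoly_le {p : ℕ} [Fact p.Prime] {f : ℚ[X]} (hf : f.Monic)
    (h : ∀ b : PadicAlgCl p, aeval b f = 0 → ‖b‖ ≤ 1) (i : ℕ) :
    ‖((f.coeff i : ℚ) : ℚ_[p])‖ ≤ 1 := by
  -- By the ultrametric inequality the closed unit ball is a subring. It contains every root, hence
  -- the coefficients of the product of the linear factors.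
  let A : Subring (PadicAlgCl p) :=
    { carrier := {x | ‖x‖ ≤ 1}
      mul_mem' := fun {a b} ha hb => by
        simp only [Set.mem_ofPred] at *
        rw [norm_mul]
        exact mul_le_one₀ ha (norm_nonneg _) hb
      one_mem' := by simp
      add_mem' := fun {a b} ha hb => (PadicAlgCl.isNonarchimedean p a b).trans (max_le ha hb)
      zero_mem' := by simp
      neg_mem' := fun {a} ha => by simpa using ha }
  have hs := (IsAlgClosed.splits (f.map (algebraMap ℚ (PadicAlgCl p)))).eq_prod_roots
  rw [(hf.map _).leadingCoeff, C_1, one_mul] at hs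
  have hl : f.map (algebraMap ℚ (PadicAlgCl p)) ∈ lifts A.subtype := by
    rw [hs]
    refine Submonoid.multiset_prod_mem (lifts A.subtype).toSubmonoid _ fun q hq => ?_
    obtain ⟨b, hb, rfl⟩ := Multiset.mem_map.1 hq
    have hb' : aeval b f = 0 := by
      have := (mem_roots'.1 hb).2
      rwa [IsRoot.def, eval_map_algebraMap] at this
    change X - C b ∈ lifts A.subtype
    rw [lifts_iff_liftsRing]
    exact sub_mem ((lifts_iff_liftsRing _ _).1 (X_mem_lifts _))
      ((lifts_iff_liftsRing _ _).1 (C_mem_lifts A.subtype ⟨b, h b hb'⟩))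
  rw [lifts_iff_coeff_lifts] at hl
  obtain ⟨x, hx⟩ := hl i
  have hx2 : ‖(x : PadicAlgCl p)‖ ≤ 1 := x.2
  have hx3 : (x : PadicAlgCl p) = algebraMap ℚ_[p] (PadicAlgCl p) ((f.coeff i : ℚ) : ℚ_[p]) := by
    change A.subtype x = _
    rw [hx, coeff_map]
    simp
  rw [hx3] at hx2
  exact (PadicAlgCl.norm_extends p _).symm.trans_le hx2

theorem Rat.exists_intCast_of_forall_padic_norm_le {q : ℚ}
    (h : ∀ (p : ℕ) [Fact p.Prime], ‖(q : ℚ_[p])‖ ≤ 1) : ∃ z : ℤ, (z : ℚ) = q := by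
  refine ⟨q.num, ?_⟩
  have : q.den = 1 := by
    by_contra hq
    obtain ⟨p, hp, hpq⟩ := Nat.exists_prime_and_dvd hq
    have := Fact.mk hp
    have h1 : (q : ℚ_[p]) * ((q.den : ℤ) : ℚ_[p]) = ((q.num : ℤ) : ℚ_[p]) := by
      exact_mod_cast congrArg (Rat.cast : ℚ → ℚ_[p]) (Rat.mul_den_eq_num q)
    have h2 : ‖((q.den : ℤ) : ℚ_[p])‖ < 1 :=
      Padic.norm_intCast_lt_one_iff.2 (Int.natCast_dvd_natCast.2 hpq)
    have h3 : ‖((q.num : ℤ) : ℚ_[p])‖ < 1 := by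
      rw [← h1, norm_mul]
      exact mul_lt_one_of_nonneg_of_lt_one_right (h p) (norm_nonneg _) h2
    have h4 : p ∣ q.num.natAbs := Int.natCast_dvd.1 (Padic.norm_intCast_lt_one_iff.1 h3)
    exact hp.one_lt.ne' (Nat.dvd_one.1 (q.reduced ▸ Nat.dvd_gcd h4 hpq))
  exact (Rat.den_eq_one_iff q).1 this

/-- A complex number all of whose `p`-adic conjugates have norm at most one is integral. -/
theorem isIntegral_of_forall_padicAlgCl_norm_le {a : ℂ} (ha : IsAlgebraic ℚ a)
    (h : ∀ (p : ℕ) [Fact p.Prime] (b : PadicAlgCl p), aeval b (minpoly ℚ a) = 0 → ‖b‖ ≤ 1) :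
    IsIntegral ℤ a := by
  have hm := minpoly.monic ha.isIntegral
  have hl : minpoly ℚ a ∈ lifts (Int.castRingHom ℚ) := by
    rw [lifts_iff_coeff_lifts]
    intro i
    obtain ⟨z, hz⟩ := Rat.exists_intCast_of_forall_padic_norm_le (q := (minpoly ℚ a).coeff i)
      fun p _ => PadicAlgCl.norm_coeff_minpoly_le hm (h p) i
    exact ⟨z, by simpa using hz⟩
  obtain ⟨f, hf, -, hfm⟩ := lifts_and_natDegree_eq_and_monic hl hm
  refine ⟨f, hfm, ?_⟩
  have h0 := minpoly.aeval ℚ a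
  rw [← hf, aeval_def, eval₂_map] at h0
  rwa [RingHom.ext_int ((algebraMap ℚ ℂ).comp (Int.castRingHom ℚ)) (algebraMap ℤ ℂ)] at h0

/-- **Tits' lemma**: a nonzero complex number that is not a root of unity is moved off the unit
circle by an embedding of `ℂ` into some normed field. -/
theorem exists_ringHom_norm_ne_one {a : ℂ} (ha : ∀ n : ℕ, 0 < n → a ^ n ≠ 1) :
    ∃ (k : Type) (_ : NormedField k) (σ : ℂ →+* k), ‖σ a‖ ≠ 1 := by
  have hcard : ℵ₀ < #ℂ := by
    rw [Cardinal.mk_complex]; exact aleph0_lt_continuum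
  by_cases ht : IsAlgebraic ℚ a
  · by_cases hi : IsIntegral ℤ a
    -- Automorphisms of `ℂ` reach every conjugate of `a`, so all conjugates would lie on the unit
    -- circle, and Kronecker's theorem would make `a` a root of unity.
    · by_contra! hcon
      let K := IntermediateField.adjoin ℚ {a}
      have : FiniteDimensional ℚ K := IntermediateField.adjoin.finiteDimensional ht.isIntegral
      have : NumberField K := ⟨⟩
      let a' : K := IntermediateField.AdjoinSimple.gen ℚ a
      have hi' : IsIntegral ℤ a' := by
        rw [← isIntegral_algHom_iff (algebraMap K ℂ).toIntAlgHom (algebraMap K ℂ).injective]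
        exact hi
      obtain ⟨n, hn, h1⟩ := NumberField.Embeddings.pow_eq_one_of_norm_eq_one K ℂ hi' fun φ => by
        have hr : aeval (φ a') (minpoly ℚ a) = 0 := by
          have h2 : minpoly ℚ a = minpoly ℚ a' := by
            rw [← minpoly.algebraMap_eq (B' := ℂ) (algebraMap K ℂ).injective]; rfl
          rw [h2]
          have := Polynomial.aeval_algHom_apply (φ.toRatAlgHom) a' (minpoly ℚ a')
          rw [minpoly.aeval, map_zero] at this
          exact this
        obtain ⟨e, he⟩ := IsAlgClosed.exists_ringEquiv_of_aeval_minpoly hcard rfl ht hr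
        rw [← he]
        exact hcon ℂ _ e.toRingHom
      refine ha n hn ?_
      have h3 := congrArg (algebraMap K ℂ) h1
      rwa [map_pow, map_one] at h3
    · have := mt (isIntegral_of_forall_padicAlgCl_norm_le ht) hi
      push Not at this
      obtain ⟨p, hp, b, hb, hb1⟩ := this
      obtain ⟨e, he⟩ := IsAlgClosed.exists_ringEquiv_of_aeval_minpoly hcard
        (by rw [PadicAlgCl.cardinalMk, Cardinal.mk_complex]) ht hb
      exact ⟨PadicAlgCl p, inferInstance, e.toRingHom, by
        change ‖e a‖ ≠ 1
        rw [he]; exact hb1.ne'⟩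
  · have ht : Transcendental ℚ a := ht
    have ht2 : Transcendental ℚ (2 * a) := by
      intro h
      refine ht ?_
      have := (isAlgebraic_algebraMap (R := ℚ) (A := ℂ) (1 / 2)).mul h
      simpa using this
    have : Countable ℚ[X] := by
      rw [← Cardinal.mk_le_aleph0_iff]
      simp
    -- Both `a` and `2 * a` are transcendental, so an automorphism of `ℂ` takes one to the other;
    -- they cannot both have norm 1.
    obtain ⟨e, he⟩ := IsAlgClosed.exists_ringEquiv_of_countable (aeval (R := ℚ) a).toRingHom
      (aeval (R := ℚ) (2 * a)).toRingHom (transcendental_iff_injective.1 ht)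
      (transcendental_iff_injective.1 ht2) hcard rfl
    have hea : e a = 2 * a := by simpa using he X
    by_cases h1 : ‖a‖ = 1
    · refine ⟨ℂ, inferInstance, e.toRingHom, ?_⟩
      change ‖e a‖ ≠ 1
      rw [hea, norm_mul, h1]
      norm_num
    · exact ⟨ℂ, inferInstance, RingHom.id ℂ, h1⟩

end AbsoluteValues

/-! ### Root-of-unity traces in finitely generated fields -/

section FinitelyGeneratedFields

open Polynomial

/-- Algebraic elements that are linearly independent over the ground field stay so over a purely
transcendental subextension. -/
theorem AlgebraicIndependent.linearIndependent_adjoin {F Ω ι κ : Type*} [Field F] [Field Ω]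
    [Algebra F Ω] {x : ι → Ω} (hx : AlgebraicIndependent F x) {v : κ → Ω}
    (hv : LinearIndependent F v) (hva : ∀ k, IsAlgebraic F (v k)) :
    LinearIndependent (Algebra.adjoin F (Set.range x)) v := by
  classical
  have hx' : AlgebraicIndependent (algebraicClosure F Ω) x := hx.algebraicClosure
  rw [linearIndependent_iff']
  intro s g hg i hi
  have hP : ∀ i, ∃ P : MvPolynomial ι F, MvPolynomial.aeval x P = (g i : Ω) := fun i => by
    exact (Algebra.adjoin_range_eq_range_aeval F x).le (g i).2
  choose P hP using hP
  let w : κ → algebraicClosure F Ω := fun k => ⟨v k, mem_algebraicClosure_iff.2 (hva k)⟩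
  -- The family `x` stays independent over the algebraic closure of `F` in `Ω`, so the relation is a
  -- polynomial identity and can be read coefficient by coefficient.
  have hQ : ∑ i ∈ s, MvPolynomial.C (w i) *
      MvPolynomial.map (algebraMap F (algebraicClosure F Ω)) (P i) = 0 := by
    refine hx' ?_
    rw [map_zero, map_sum, ← hg]
    refine Finset.sum_congr rfl fun j _ => ?_
    rw [map_mul, MvPolynomial.aeval_C, MvPolynomial.aeval_map_algebraMap, hP j, mul_comm]
    rfl
  have hPi : P i = 0 := by
    ext m
    have h1 := congrArg (fun q => algebraMap (algebraicClosure F Ω) Ω (q.coeff m)) hQ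
    simp only [MvPolynomial.coeff_sum, MvPolynomial.coeff_C_mul, MvPolynomial.coeff_map,
      map_sum, map_mul, MvPolynomial.coeff_zero, map_zero] at h1
    refine linearIndependent_iff'.1 hv s (fun j => (P j).coeff m) ?_ i hi
    rw [← h1]
    refine Finset.sum_congr rfl fun j _ => ?_
    rw [Algebra.smul_def, mul_comm]
    rfl
  have := hP i
  rw [hPi, map_zero] at this
  exact Subtype.ext this.symm

open scoped IntermediateField.algebraAdjoinAdjoin in
/-- The algebraic elements of a finitely generated field extension have bounded degree. -/
theorem IntermediateField.exists_natDegree_minpoly_le {F Ω : Type*} [Field F] [Field Ω]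
    [Algebra F Ω] {S : Set Ω} (hS : S.Finite) :
    ∃ d, ∀ t ∈ IntermediateField.adjoin F S, IsAlgebraic F t → (minpoly F t).natDegree ≤ d := by
  have : Finite S := hS
  -- With `B` a transcendence basis inside `S`, the bound is the degree of `F(S)` over `F(B)`:
  -- powers of `t` independent over `F` remain so over `F(B)`.
  obtain ⟨B, hB⟩ := (AlgebraicIndependent.matroid F Ω).exists_isBasis S
  obtain ⟨hB1, hB2, hB3⟩ := AlgebraicIndependent.matroid_isBasis_iff.1 hB
  let E := IntermediateField.adjoin F B
  have hfin : FiniteDimensional E (IntermediateField.adjoin E S) :=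
    IntermediateField.finiteDimensional_adjoin fun s hs => by
      have h := hB3 s hs
      exact (h.extendScalars (S := E)
        (FaithfulSMul.algebraMap_injective (Algebra.adjoin F B) E)).isIntegral
  refine ⟨Module.finrank E (IntermediateField.adjoin E S), fun t ht hta => ?_⟩
  have htE : t ∈ IntermediateField.adjoin E S := by
    have h : IntermediateField.adjoin F S ≤ (IntermediateField.adjoin E S).restrictScalars F := by
      rw [IntermediateField.adjoin_le_iff]
      exact IntermediateField.subset_adjoin E S
    exact h ht
  have hli : LinearIndependent F fun i : Fin (minpoly F t).natDegree => t ^ (i : ℕ) :=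
    linearIndependent_pow t
  have hli2 : LinearIndependent (Algebra.adjoin F B)
      fun i : Fin (minpoly F t).natDegree => t ^ (i : ℕ) := by
    have h := AlgebraicIndependent.linearIndependent_adjoin hB1 hli fun k => hta.pow _
    rw [show Set.range (fun i : B => id (i : Ω)) = B from Subtype.range_coe] at h
    exact h
  have hli3 : LinearIndependent E fun i : Fin (minpoly F t).natDegree => t ^ (i : ℕ) :=
    (LinearIndependent.iff_fractionRing (Algebra.adjoin F B) E).1 hli2
  let u : Fin (minpoly F t).natDegree → IntermediateField.adjoin E S :=
    fun i => (⟨t, htE⟩ : IntermediateField.adjoin E S) ^ (i : ℕ)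
  have hu : LinearIndependent E u :=
    LinearIndependent.of_comp (IntermediateField.adjoin E S).val.toLinearMap hli3
  simpa using hu.fintype_card_le_finrank

/-- A finitely generated field of real numbers contains only finitely many numbers of the form
`ζ + ζ⁻¹` with `ζ` a root of unity. -/
theorem finite_rootOfUnity_traces {S : Set ℝ} (hS : S.Finite) :
    {t : ℝ | t ∈ IntermediateField.adjoin ℚ S ∧
      ∃ (ζ : ℂ) (n : ℕ), 0 < n ∧ ζ ^ n = 1 ∧ (t : ℂ) = ζ + ζ⁻¹}.Finite := by
  classical
  obtain ⟨d, hd⟩ := IntermediateField.exists_natDegree_minpoly_le (F := ℚ) hS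
  -- Bound for the coefficients of a monic polynomial of degree at most `d` with all roots of
  -- absolute value at most 2.
  let N : ℕ := ⌈(max 2 1 ^ d * d.choose (d / 2) : ℝ)⌉₊
  refine ((bUnion_roots_finite (Int.castRingHom ℂ) d
    (Set.finite_Icc (-N : ℤ) N)).preimage Complex.ofReal_injective.injOn).subset ?_
  rintro t ⟨htS, ζ, n, hn, hζ, ht⟩
  have hζi : IsIntegral ℤ ζ := IsIntegral.of_pow hn (hζ ▸ isIntegral_one)
  have hζi' : IsIntegral ℤ ζ⁻¹ := IsIntegral.of_pow hn (by
    rw [inv_pow, hζ, inv_one]; exact isIntegral_one)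
  have hti : IsIntegral ℤ (t : ℂ) := ht ▸ hζi.add hζi'
  have htQ : IsIntegral ℚ (t : ℂ) := hti.tower_top
  have hmin : minpoly ℚ (t : ℂ) = minpoly ℚ t :=
    minpoly.algebraMap_eq (B' := ℂ) (A := ℚ) (algebraMap ℝ ℂ).injective t
  have hmap := minpoly.isIntegrallyClosed_eq_field_fractions' ℚ hti
  have hmon := minpoly.monic hti
  have hmapC : (minpoly ℤ (t : ℂ)).map (Int.castRingHom ℂ) =
      (minpoly ℚ (t : ℂ)).map (algebraMap ℚ ℂ) := by
    rw [hmap, Polynomial.map_map]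
    congr 1
  have hdeg : (minpoly ℤ (t : ℂ)).natDegree ≤ d := by
    have h1 : (minpoly ℚ (t : ℂ)).natDegree = (minpoly ℤ (t : ℂ)).natDegree := by
      rw [hmap, hmon.natDegree_map]
    rw [← h1, hmin]
    refine hd t htS ?_
    have h2 : IsAlgebraic ℚ (algebraMap ℝ ℂ t) := htQ.isAlgebraic
    exact (isAlgebraic_algebraMap_iff (algebraMap ℝ ℂ).injective).1 h2
  have hroots : ∀ z ∈ ((minpoly ℤ (t : ℂ)).map (Int.castRingHom ℂ)).roots, ‖z‖ ≤ 2 := by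
    intro z hz
    have hz' : aeval z (minpoly ℚ (t : ℂ)) = 0 := by
      have := (mem_roots'.1 hz).2
      rwa [hmapC, IsRoot.def, eval_map_algebraMap] at this
    obtain ⟨e, he⟩ := IsAlgClosed.exists_ringEquiv_of_aeval_minpoly
      (by rw [Cardinal.mk_complex]; exact Cardinal.aleph0_lt_continuum) rfl htQ.isAlgebraic hz'
    have h1 : ‖e ζ‖ = 1 := by
      refine Complex.norm_eq_one_of_pow_eq_one (n := n) ?_ hn.ne'
      rw [← map_pow, hζ, map_one]
    rw [← he, ht, map_add, map_inv₀]
    refine (norm_add_le _ _).trans ?_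
    rw [norm_inv, h1]
    norm_num
  refine Set.mem_iUnion₂.2 ⟨minpoly ℤ (t : ℂ), ⟨hdeg, fun i => ?_⟩, ?_⟩
  · have h := coeff_bdd_of_roots_le (B := 2) (Int.castRingHom ℂ) hmon
      (IsAlgClosed.splits _) hdeg hroots i
    rw [coeff_map] at h
    have h2 : (|(minpoly ℤ (t : ℂ)).coeff i| : ℝ) ≤ N := by
      refine le_trans ?_ (Nat.le_ceil _)
      simpa using h
    have h3 : |(minpoly ℤ (t : ℂ)).coeff i| ≤ (N : ℤ) := by exact_mod_cast h2
    exact abs_le.1 h3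
  · rw [Finset.mem_coe, Multiset.mem_toFinset, mem_roots (hmon.map _).ne_zero, hmapC, IsRoot.def,
      eval_map_algebraMap, minpoly.aeval]

end FinitelyGeneratedFields

/-! ### Limit directions and the trace form -/

section LimitDirections

open Filter

/-- The traceless part of a two by two matrix. -/
noncomputable def tracelessPart (A : Matrix (Fin 2) (Fin 2) ℝ) : Matrix (Fin 2) (Fin 2) ℝ :=
  A - (A.trace / 2) • 1

/-- The polar form of minus the determinant on traceless matrices. -/
noncomputable def halfTraceForm (X Y : Matrix (Fin 2) (Fin 2) ℝ) : ℝ := (X * Y).trace / 2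

theorem continuous_tracelessPart : Continuous tracelessPart := by
  unfold tracelessPart
  fun_prop

theorem trace_tracelessPart (A : Matrix (Fin 2) (Fin 2) ℝ) : (tracelessPart A).trace = 0 := by
  simp [tracelessPart, Matrix.trace_fin_two]

@[simp]
theorem tracelessPart_one : tracelessPart 1 = 0 := by
  simp [tracelessPart]

theorem tracelessPart_conj (h g : SL(2, ℝ)) :
    tracelessPart (h * g * h⁻¹ : SL(2, ℝ)) =
      (h : Matrix (Fin 2) (Fin 2) ℝ) * tracelessPart g * (h⁻¹ : SL(2, ℝ)) := by
  have h1 : (h : Matrix (Fin 2) (Fin 2) ℝ) * (h⁻¹ : SL(2, ℝ)) = 1 := by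
    rw [← Matrix.SpecialLinearGroup.coe_mul, mul_inv_cancel, Matrix.SpecialLinearGroup.coe_one]
  have h2 : ((h⁻¹ : SL(2, ℝ)) : Matrix (Fin 2) (Fin 2) ℝ) * h = 1 := by
    rw [← Matrix.SpecialLinearGroup.coe_mul, inv_mul_cancel, Matrix.SpecialLinearGroup.coe_one]
  simp only [tracelessPart, Matrix.SpecialLinearGroup.coe_mul]
  rw [mul_sub, sub_mul, Matrix.trace_mul_comm _ ((h⁻¹ : SL(2, ℝ)) : Matrix (Fin 2) (Fin 2) ℝ),
    ← mul_assoc, h2, one_mul, mul_smul_comm, smul_mul_assoc, mul_one, h1]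

theorem halfTraceForm_smul_smul (c : ℝ) (X Y : Matrix (Fin 2) (Fin 2) ℝ) :
    halfTraceForm (c • X) (c • Y) = c ^ 2 * halfTraceForm X Y := by
  simp [halfTraceForm, Matrix.trace_smul]
  ring

theorem trace_conj_eq (h g : SL(2, ℝ)) :
    ((h * g * h⁻¹ : SL(2, ℝ)) : Matrix (Fin 2) (Fin 2) ℝ).trace =
      (g : Matrix (Fin 2) (Fin 2) ℝ).trace := by
  rw [mul_assoc, Matrix.SpecialLinearGroup.coe_mul, Matrix.trace_mul_comm, ← Matrix.SpecialLinearGroup.coe_mul,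
    inv_mul_cancel_right]

/-- Write each matrix as half its trace plus its traceless part; determinant 1 expresses the squared
trace through the form. -/
theorem trace_mul_eq (a b : SL(2, ℝ))
    (hab : (b : Matrix (Fin 2) (Fin 2) ℝ).trace = (a : Matrix (Fin 2) (Fin 2) ℝ).trace) :
    ((a * b : SL(2, ℝ)) : Matrix (Fin 2) (Fin 2) ℝ).trace = 2 +
      2 * (halfTraceForm (tracelessPart a) (tracelessPart a) +
        halfTraceForm (tracelessPart a) (tracelessPart b)) := by
  have ha := a.det_coe
  rw [Matrix.det_fin_two] at ha
  simp only [halfTraceForm, tracelessPart, Matrix.SpecialLinearGroup.coe_mul, Matrix.trace_fin_two,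
    Matrix.mul_apply, Fin.sum_univ_two, Matrix.sub_apply, Matrix.smul_apply, Matrix.one_apply,
    smul_eq_mul] at *
  simp
  have hb : b 1 1 = a 0 0 + a 1 1 - b 0 0 := by linarith
  rw [hb]
  linear_combination 2 * ha

theorem trace_mul_inv_eq (a b : SL(2, ℝ))
    (hab : (b : Matrix (Fin 2) (Fin 2) ℝ).trace = (a : Matrix (Fin 2) (Fin 2) ℝ).trace) :
    ((a * b⁻¹ : SL(2, ℝ)) : Matrix (Fin 2) (Fin 2) ℝ).trace = 2 +
      2 * (halfTraceForm (tracelessPart a) (tracelessPart a) -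
        halfTraceForm (tracelessPart a) (tracelessPart b)) := by
  have ha := a.det_coe
  rw [Matrix.det_fin_two] at ha
  simp only [halfTraceForm, tracelessPart, Matrix.SpecialLinearGroup.coe_mul, Matrix.trace_fin_two,
    Matrix.mul_apply, Fin.sum_univ_two, Matrix.sub_apply, Matrix.smul_apply, Matrix.one_apply,
    smul_eq_mul, Matrix.SpecialLinearGroup.coe_inv, Matrix.adjugate_fin_two] at *
  simp
  have hb : b 1 1 = a 0 0 + a 1 1 - b 0 0 := by linarith
  rw [hb]
  linear_combination 2 * ha

/-- Complements the two previous identities: traces at least 2 for `a * b` and `a * b⁻¹` bound the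
mixed term above by the diagonal one in absolute value, and the commutator gives the reverse bound.
-/
theorem trace_commutator_eq (a b : SL(2, ℝ))
    (hab : (b : Matrix (Fin 2) (Fin 2) ℝ).trace = (a : Matrix (Fin 2) (Fin 2) ℝ).trace) :
    ((a * b * a⁻¹ * b⁻¹ : SL(2, ℝ)) : Matrix (Fin 2) (Fin 2) ℝ).trace = 2 +
      4 * (halfTraceForm (tracelessPart a) (tracelessPart b) ^ 2 -
        halfTraceForm (tracelessPart a) (tracelessPart a) ^ 2) := by
  have ha := a.det_coe
  have hb := b.det_coe
  rw [Matrix.det_fin_two] at ha hb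
  simp only [halfTraceForm, tracelessPart, Matrix.SpecialLinearGroup.coe_mul, Matrix.trace_fin_two,
    Matrix.mul_apply, Fin.sum_univ_two, Matrix.sub_apply, Matrix.smul_apply, Matrix.one_apply,
    smul_eq_mul, Matrix.SpecialLinearGroup.coe_inv, Matrix.adjugate_fin_two] at *
  simp
  have hb1 : b 1 1 = a 0 0 + a 1 1 - b 0 0 := by linarith
  rw [hb1] at hb ⊢
  linear_combination (-(a 0 0 + a 1 1) ^ 2 + 4 * (a 0 0 * a 1 1 - a 0 1 * a 1 0) + 2) * ha +
    ((a 0 0 + a 1 1) ^ 2 - 2 * (a 0 0 * a 1 1 - a 0 1 * a 1 0)) * hb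

theorem tracelessPart_inv (g : SL(2, ℝ)) :
    tracelessPart (g⁻¹ : SL(2, ℝ)) = -tracelessPart g := by
  ext i j
  fin_cases i <;> fin_cases j <;>
    simp [tracelessPart, Matrix.SpecialLinearGroup.coe_inv, Matrix.adjugate_fin_two,
      Matrix.trace_fin_two] <;> ring

theorem tracelessPart_mul (A B : Matrix (Fin 2) (Fin 2) ℝ) :
    tracelessPart (A * B) = (B.trace / 2) • tracelessPart A + (A.trace / 2) • tracelessPart B +
      tracelessPart (tracelessPart A * tracelessPart B) := by
  ext i j
  fin_cases i <;> fin_cases j <;>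
    simp [tracelessPart, Matrix.trace_fin_two, Matrix.mul_apply] <;> ring

theorem tracelessPart_smul (c : ℝ) (A : Matrix (Fin 2) (Fin 2) ℝ) :
    tracelessPart (c • A) = c • tracelessPart A := by
  simp [tracelessPart, smul_sub, smul_smul, mul_div_assoc]

theorem tracelessPart_eq_zero_iff {g : SL(2, ℝ)} :
    tracelessPart g = 0 ↔ g ∈ Subgroup.center SL(2, ℝ) := by
  rw [Matrix.SpecialLinearGroup.mem_center_iff]
  have hd := g.det_coe
  constructor
  · intro h
    have hg : (g : Matrix (Fin 2) (Fin 2) ℝ) =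
        Matrix.scalar (Fin 2) ((g : Matrix (Fin 2) (Fin 2) ℝ).trace / 2) := by
      rw [tracelessPart, sub_eq_zero] at h
      rw [h]
      ext i j
      fin_cases i <;> fin_cases j <;> simp
    refine ⟨_, ?_, hg.symm⟩
    rw [hg, Matrix.scalar_apply, Matrix.det_diagonal, Finset.prod_const, Finset.card_univ] at hd
    exact hd
  · rintro ⟨r, -, hr⟩
    rw [← hr]
    ext i j
    fin_cases i <;> fin_cases j <;> simp [tracelessPart]

/-- A matrix is a limit direction of a group `Γ` of matrices if it is a limit of rescaled traceless
parts of elements of `Γ` that tend to the identity. -/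
def IsLimitDirection (Γ : Subgroup SL(2, ℝ)) (X : Matrix (Fin 2) (Fin 2) ℝ) : Prop :=
  ∃ (l : Filter SL(2, ℝ)) (g : SL(2, ℝ) → SL(2, ℝ)) (c : SL(2, ℝ) → ℝ), l.NeBot ∧
    Tendsto g l (𝓝 1) ∧ (∀ᶠ s in l, g s ∈ Γ) ∧
    Tendsto (fun s => c s • tracelessPart (g s)) l (𝓝 X)

section

attribute [local instance] Matrix.normedAddCommGroup Matrix.normedSpace

/-- The traceless part vanishes only at central elements, so it can be normalised to the unit
sphere, where compactness gives a limit along an ultrafilter. -/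
theorem exists_isLimitDirection {Γ : Subgroup SL(2, ℝ)}
    (hΓ : ∀ U ∈ 𝓝 (1 : SL(2, ℝ)), ∃ g ∈ U, g ∈ Γ ∧ g ∉ Subgroup.center SL(2, ℝ)) :
    ∃ X, X ≠ 0 ∧ IsLimitDirection Γ X := by
  have hne : (𝓝 (1 : SL(2, ℝ)) ⊓ 𝓟 {g | g ∈ Γ ∧ g ∉ Subgroup.center SL(2, ℝ)}).NeBot := by
    rw [Filter.inf_principal_neBot_iff]
    intro U hU
    obtain ⟨g, hg, hg'⟩ := hΓ U hU
    exact ⟨g, hg, hg'⟩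
  obtain ⟨l, hl⟩ := Ultrafilter.exists_le (𝓝 (1 : SL(2, ℝ)) ⊓
    𝓟 {g | g ∈ Γ ∧ g ∉ Subgroup.center SL(2, ℝ)})
  have hl1 : (l : Filter SL(2, ℝ)) ≤ 𝓝 1 := hl.trans inf_le_left
  have hl2 : ∀ᶠ g in (l : Filter SL(2, ℝ)), g ∈ Γ ∧ g ∉ Subgroup.center SL(2, ℝ) :=
    le_principal_iff.1 (hl.trans inf_le_right)
  let c : SL(2, ℝ) → ℝ := fun g => ‖tracelessPart g‖⁻¹
  have hs : ∀ᶠ g in (l : Filter SL(2, ℝ)), c g • tracelessPart g ∈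
      Metric.sphere (0 : Matrix (Fin 2) (Fin 2) ℝ) 1 := by
    filter_upwards [hl2] with g hg
    have h0 : ‖tracelessPart g‖ ≠ 0 := norm_ne_zero_iff.2 (mt tracelessPart_eq_zero_iff.1 hg.2)
    rw [mem_sphere_zero_iff_norm, norm_smul, norm_inv, norm_norm, inv_mul_cancel₀ h0]
  have : ProperSpace (Matrix (Fin 2) (Fin 2) ℝ) := FiniteDimensional.proper_real _
  obtain ⟨X, hX, hlX⟩ := (isCompact_sphere (0 : Matrix (Fin 2) (Fin 2) ℝ) 1).ultrafilter_le_nhds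
    (l.map fun g => c g • tracelessPart g) (le_principal_iff.2 hs)
  refine ⟨X, ?_, l, id, c, inferInstance, hl1, hl2.mono fun g hg => hg.1, hlX⟩
  rintro rfl
  simp at hX

end

namespace IsLimitDirection

variable {Γ : Subgroup SL(2, ℝ)} {X : Matrix (Fin 2) (Fin 2) ℝ}

theorem trace_eq_zero (hX : IsLimitDirection Γ X) : X.trace = 0 := by
  obtain ⟨l, g, c, hl, -, -, hX⟩ := hX
  have h : Continuous fun A : Matrix (Fin 2) (Fin 2) ℝ => A.trace := by fun_prop
  refine tendsto_nhds_unique ((h.tendsto X).comp hX) ?_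
  refine tendsto_const_nhds.congr fun s => ?_
  simp [trace_tracelessPart]

theorem tendsto_conj {l : Filter SL(2, ℝ)} {g : SL(2, ℝ) → SL(2, ℝ)} (hg : Tendsto g l (𝓝 1))
    (h : SL(2, ℝ)) : Tendsto (fun s => h * g s * h⁻¹) l (𝓝 1) := by
  have := ((tendsto_const_nhds (x := h)).mul hg).mul (tendsto_const_nhds (x := h⁻¹))
  simpa using this

theorem tendsto_smul_tracelessPart_conj {l : Filter SL(2, ℝ)} {g : SL(2, ℝ) → SL(2, ℝ)}
    {c : SL(2, ℝ) → ℝ} (hX : Tendsto (fun s => c s • tracelessPart (g s)) l (𝓝 X))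
    (h : SL(2, ℝ)) : Tendsto (fun s => c s • tracelessPart (h * g s * h⁻¹ : SL(2, ℝ))) l
      (𝓝 (h * X * (h⁻¹ : SL(2, ℝ)))) := by
  have := ((tendsto_const_nhds (x := (h : Matrix (Fin 2) (Fin 2) ℝ))).mul hX).mul
    (tendsto_const_nhds (x := ((h⁻¹ : SL(2, ℝ)) : Matrix (Fin 2) (Fin 2) ℝ)))
  refine this.congr fun s => ?_
  rw [tracelessPart_conj, mul_smul_comm, smul_mul_assoc]

/-- To first order at the identity, multiplication is addition of traceless parts: the half traces
tend to 1 and the quadratic term of `tracelessPart_mul` vanishes in the limit. The common scale `c`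
is essential. -/
theorem of_mul {Y : Matrix (Fin 2) (Fin 2) ℝ} {l : Filter SL(2, ℝ)} [l.NeBot]
    {g k : SL(2, ℝ) → SL(2, ℝ)} {c : SL(2, ℝ) → ℝ}
    (hg : Tendsto g l (𝓝 1)) (hk : Tendsto k l (𝓝 1)) (hgΓ : ∀ᶠ s in l, g s ∈ Γ)
    (hkΓ : ∀ᶠ s in l, k s ∈ Γ) (hX : Tendsto (fun s => c s • tracelessPart (g s)) l (𝓝 X))
    (hY : Tendsto (fun s => c s • tracelessPart (k s)) l (𝓝 Y)) :
    IsLimitDirection Γ (X + Y) := by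
  refine ⟨l, fun s => g s * k s, c, inferInstance, by simpa using hg.mul hk, ?_, ?_⟩
  · filter_upwards [hgΓ, hkΓ] with s h1 h2 using mul_mem h1 h2
  have hval : Continuous fun a : SL(2, ℝ) => (a : Matrix (Fin 2) (Fin 2) ℝ) :=
    continuous_subtype_val
  have htr : Continuous fun a : SL(2, ℝ) => (a : Matrix (Fin 2) (Fin 2) ℝ).trace / 2 := by
    fun_prop
  have h1 := (htr.tendsto 1).comp hg
  have h2 := (htr.tendsto 1).comp hk
  have h3 := ((continuous_tracelessPart.comp hval).tendsto 1).comp hk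
  have h4 := ((h2.smul hX).add (h1.smul hY)).add
    ((continuous_tracelessPart.tendsto _).comp (hX.mul h3))
  simp only [Function.comp_def, Matrix.SpecialLinearGroup.coe_one, Matrix.trace_one,
    tracelessPart_one, mul_zero] at h4
  have h0 : tracelessPart 0 = 0 := by simp [tracelessPart]
  rw [h0] at h4
  norm_num at h4
  refine h4.congr fun s => ?_
  rw [Matrix.SpecialLinearGroup.coe_mul, tracelessPart_mul, smul_add, smul_add, tracelessPart_smul,
    smul_comm (c s), smul_comm (c s)]

theorem add_conj (hX : IsLimitDirection Γ X) {h : SL(2, ℝ)} (hh : h ∈ Γ) :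
    IsLimitDirection Γ (X + h * X * (h⁻¹ : SL(2, ℝ))) := by
  obtain ⟨l, g, c, hl, hg, hgΓ, hX⟩ := hX
  exact of_mul hg (tendsto_conj hg h) hgΓ
    (hgΓ.mono fun s hs => mul_mem (mul_mem hh hs) (inv_mem hh)) hX
    (tendsto_smul_tracelessPart_conj hX h)

theorem sub_conj (hX : IsLimitDirection Γ X) {h : SL(2, ℝ)} (hh : h ∈ Γ) :
    IsLimitDirection Γ (X - h * X * (h⁻¹ : SL(2, ℝ))) := by
  obtain ⟨l, g, c, hl, hg, hgΓ, hX⟩ := hX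
  rw [sub_eq_add_neg]
  refine of_mul (k := fun s => (h * g s * h⁻¹)⁻¹) hg ?_ hgΓ
    (hgΓ.mono fun s hs => inv_mem (mul_mem (mul_mem hh hs) (inv_mem hh))) hX ?_
  · simpa using (tendsto_conj hg h).inv
  · refine (tendsto_smul_tracelessPart_conj hX h).neg.congr fun s => ?_
    rw [tracelessPart_inv, smul_neg]

/-- If all elements of `Γ` near the identity have trace at least two, then the orbit of a limit
direction consists of pairwise tangent vectors. -/
theorem halfTraceForm_conj_sq (hX : IsLimitDirection Γ X)
    (hΓ : ∀ᶠ g : SL(2, ℝ) in 𝓝 1, g ∈ Γ → 2 ≤ (g : Matrix (Fin 2) (Fin 2) ℝ).trace)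
    {h : SL(2, ℝ)} (hh : h ∈ Γ) :
    halfTraceForm X (h * X * (h⁻¹ : SL(2, ℝ))) ^ 2 = halfTraceForm X X ^ 2 := by
  obtain ⟨l, g, c, hl, hg, hgΓ, hX⟩ := hX
  have hk := tendsto_conj hg h
  have hkΓ : ∀ᶠ s in l, h * g s * h⁻¹ ∈ Γ :=
    hgΓ.mono fun s hs => mul_mem (mul_mem hh hs) (inv_mem hh)
  have e1 := Tendsto.eventually (show Tendsto (fun s => g s * (h * g s * h⁻¹)) l (𝓝 1) by
    simpa using hg.mul hk) hΓ
  have e2 := Tendsto.eventually (show Tendsto (fun s => g s * (h * g s * h⁻¹)⁻¹) l (𝓝 1) by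
    simpa using hg.mul hk.inv) hΓ
  have e3 := Tendsto.eventually (show Tendsto
    (fun s => g s * (h * g s * h⁻¹) * (g s)⁻¹ * (h * g s * h⁻¹)⁻¹) l (𝓝 1) by
    simpa using ((hg.mul hk).mul hg.inv).mul hk.inv) hΓ
  have hcont : Continuous fun p : Matrix (Fin 2) (Fin 2) ℝ × Matrix (Fin 2) (Fin 2) ℝ =>
      halfTraceForm p.1 p.2 ^ 2 := by
    unfold halfTraceForm
    fun_prop
  have hY := tendsto_smul_tracelessPart_conj hX h
  have h1 := (hcont.tendsto _).comp (hX.prodMk_nhds hY)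
  have h2 := (hcont.tendsto _).comp (hX.prodMk_nhds hX)
  refine tendsto_nhds_unique h1 (h2.congr' ?_)
  filter_upwards [hgΓ, hkΓ, e1, e2, e3] with s hs hs' t1 t2 t3
  have ht := trace_conj_eq h (g s)
  replace t1 := t1 (mul_mem hs hs')
  replace t2 := t2 (mul_mem hs (inv_mem hs'))
  replace t3 := t3 (mul_mem (mul_mem (mul_mem hs hs') (inv_mem hs)) (inv_mem hs'))
  rw [trace_mul_eq _ _ ht] at t1
  rw [trace_mul_inv_eq _ _ ht] at t2
  rw [trace_commutator_eq _ _ ht] at t3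
  simp only [Function.comp_apply, halfTraceForm_smul_smul, mul_pow]
  congr 1
  -- `t1` and `t2` say that the diagonal value dominates the mixed one in absolute value; `t3` is
  -- the opposite inequality between squares.
  nlinarith

/-- Squares of elements near the identity also have trace at least 2, and `trace_mul_eq` with `b =
a` reads this as a sign. -/
theorem halfTraceForm_self_nonneg (hX : IsLimitDirection Γ X)
    (hΓ : ∀ᶠ g : SL(2, ℝ) in 𝓝 1, g ∈ Γ → 2 ≤ (g : Matrix (Fin 2) (Fin 2) ℝ).trace) :
    0 ≤ halfTraceForm X X := by
  obtain ⟨l, g, c, hl, hg, hgΓ, hX⟩ := hX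
  have e1 := Tendsto.eventually (show Tendsto (fun s => g s * g s) l (𝓝 1) by
    simpa using hg.mul hg) hΓ
  have hcont : Continuous fun p : Matrix (Fin 2) (Fin 2) ℝ => halfTraceForm p p := by
    unfold halfTraceForm
    fun_prop
  refine ge_of_tendsto ((hcont.tendsto _).comp hX) ?_
  filter_upwards [hgΓ, e1] with s hs t1
  replace t1 := t1 (mul_mem hs hs)
  rw [trace_mul_eq _ _ rfl] at t1
  simp only [Function.comp_apply, halfTraceForm_smul_smul]
  have : 0 ≤ halfTraceForm (tracelessPart (g s)) (tracelessPart (g s)) := by linarith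
  positivity

end IsLimitDirection

end LimitDirections

/-! ### Groups without elliptic elements near the identity -/

section Elementary

open Matrix (mulVec)
open Filter

theorem Projectivization.mk_eq_mk_iff_fin_two {K : Type*} [Field K] {v w : Fin 2 → K} (hv : v ≠ 0)
    (hw : w ≠ 0) :
    Projectivization.mk K v hv = Projectivization.mk K w hw ↔ v 0 * w 1 - v 1 * w 0 = 0 := by
  rw [Projectivization.mk_eq_mk_iff']
  constructor
  · rintro ⟨a, rfl⟩
    simp only [Pi.smul_apply, smul_eq_mul]
    ring
  · intro h
    by_cases h0 : w 0 = 0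
    · have h1 : w 1 ≠ 0 := fun h1 => hw (by ext i; fin_cases i <;> simp [h0, h1])
      have h2 : v 0 = 0 := by simpa [h0, h1] using h
      refine ⟨v 1 / w 1, ?_⟩
      ext i
      fin_cases i <;> simp [h0, h1, h2]
    · refine ⟨v 0 / w 0, ?_⟩
      ext i
      fin_cases i
      · simp [h0]
      · simp only [Pi.smul_apply, smul_eq_mul, Fin.mk_one]
        field_simp
        linear_combination h

theorem psl_smul_mk (g : SL(2, ℝ)) {v : Fin 2 → ℝ} (hv : v ≠ 0)
    (hgv : (g : Matrix (Fin 2) (Fin 2) ℝ).mulVec v ≠ 0) :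
    (g : PSL(2, ℝ)) • Projectivization.mk ℝ v hv =
      Projectivization.mk ℝ ((g : Matrix (Fin 2) (Fin 2) ℝ).mulVec v) hgv := rfl

theorem Matrix.SpecialLinearGroup.mulVec_ne_zero {K : Type*} [Field K] (g : SL(2, K))
    {v : Fin 2 → K} (hv : v ≠ 0) : (g : Matrix (Fin 2) (Fin 2) K).mulVec v ≠ 0 := by
  intro h
  have h1 : ((g⁻¹ : SL(2, K)) : Matrix (Fin 2) (Fin 2) K).mulVec
      ((g : Matrix (Fin 2) (Fin 2) K).mulVec v) = v := by
    rw [Matrix.mulVec_mulVec, ← Matrix.SpecialLinearGroup.coe_mul, inv_mul_cancel,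
      Matrix.SpecialLinearGroup.coe_one, Matrix.one_mulVec]
  rw [h, Matrix.mulVec_zero] at h1
  exact hv h1.symm

/-- The preimage in `SL(2, ℝ)` of a subgroup of `PSL(2, ℝ)`. -/
def slPreimage (H : Subgroup PSL(2, ℝ)) : Subgroup SL(2, ℝ) :=
  H.comap (QuotientGroup.mk' (Subgroup.center SL(2, ℝ)))

theorem mem_slPreimage {H : Subgroup PSL(2, ℝ)} {g : SL(2, ℝ)} :
    g ∈ slPreimage H ↔ (g : PSL(2, ℝ)) ∈ H := Iff.rfl

theorem forall_mem_of_slPreimage {H : Subgroup PSL(2, ℝ)} {P : PSL(2, ℝ) → Prop}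
    (h : ∀ g ∈ slPreimage H, P (g : PSL(2, ℝ))) : ∀ p ∈ H, P p := by
  intro p
  induction p using QuotientGroup.induction_on with
  | H g => exact h g

/-- A group that preserves the null line of a nilpotent matrix, up to orthogonality, fixes a point
at infinity. -/
theorem isElementarySubgroup_of_nilpotent {H : Subgroup PSL(2, ℝ)}
    {X : Matrix (Fin 2) (Fin 2) ℝ} (hX : X ≠ 0) (htr : X.trace = 0) (hXX : halfTraceForm X X = 0)
    (h : ∀ g ∈ slPreimage H, halfTraceForm X (g * X * (g⁻¹ : SL(2, ℝ))) = 0) :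
    IsElementarySubgroup H := by
  have h11 : X 1 1 = -X 0 0 := by
    rw [Matrix.trace_fin_two] at htr
    linarith
  have hQ : X 0 0 ^ 2 + X 0 1 * X 1 0 = 0 := by
    simp only [halfTraceForm, Matrix.trace_fin_two, Matrix.mul_apply, Fin.sum_univ_two, h11] at hXX
    linarith
  -- Here `v` spans the image of `X`, which is also its kernel. The pairing of `X` with its
  -- conjugate by `g` is a nonzero multiple of the squared determinant of `v` and `g v`.
  suffices hs : ∃ v : Fin 2 → ℝ, v ≠ 0 ∧ ∀ g ∈ slPreimage H,
      v 0 * (g : Matrix (Fin 2) (Fin 2) ℝ).mulVec v 1 -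
        v 1 * (g : Matrix (Fin 2) (Fin 2) ℝ).mulVec v 0 = 0 by
    obtain ⟨v, hv, hg⟩ := hs
    refine Or.inr (Or.inl ⟨Projectivization.mk ℝ v hv, forall_mem_of_slPreimage fun g hgH => ?_⟩)
    rw [psl_smul_mk g hv (g.mulVec_ne_zero hv), eq_comm, Projectivization.mk_eq_mk_iff_fin_two]
    exact hg g hgH
  by_cases h01 : X 0 1 = 0
  · have h00 : X 0 0 = 0 := by simpa [h01] using hQ
    have h10 : X 1 0 ≠ 0 := by
      intro h10
      refine hX ?_
      ext i j
      fin_cases i <;> fin_cases j <;> simp [h01, h00, h10, h11]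
    refine ⟨![0, 1], by simp, fun g hg => ?_⟩
    have hd := g.det_coe
    have := h g hg
    simp only [halfTraceForm, Matrix.trace_fin_two, Matrix.mul_apply, Fin.sum_univ_two, h11, h01,
      h00, Matrix.SpecialLinearGroup.coe_inv, Matrix.adjugate_fin_two] at this
    simp at this
    simp [Matrix.mulVec, dotProduct, Fin.sum_univ_two]
    grind
  · refine ⟨![X 0 1, -X 0 0], by simp [h01], fun g hg => ?_⟩
    have hd := g.det_coe
    rw [Matrix.det_fin_two] at hd
    have := h g hg
    simp only [halfTraceForm, Matrix.trace_fin_two, Matrix.mul_apply, Fin.sum_univ_two, h11,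
      Matrix.SpecialLinearGroup.coe_inv, Matrix.adjugate_fin_two] at this
    simp at this
    simp [Matrix.mulVec, dotProduct, Fin.sum_univ_two]
    grind

theorem mulVec_eigenvector_unique {X : Matrix (Fin 2) (Fin 2) ℝ} (htr : X.trace = 0) {μ : ℝ}
    (hμ : μ ≠ 0) {u v : Fin 2 → ℝ} (hu : X.mulVec u = μ • u) (hv : X.mulVec v = μ • v) :
    u 0 * v 1 - u 1 * v 0 = 0 := by
  have h11 : X 1 1 = -X 0 0 := by
    rw [Matrix.trace_fin_two] at htr
    linarith
  have u0 := congrFun hu 0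
  have u1 := congrFun hu 1
  have v0 := congrFun hv 0
  have v1 := congrFun hv 1
  simp only [Matrix.mulVec, dotProduct, Fin.sum_univ_two, Pi.smul_apply, smul_eq_mul, h11]
    at u0 u1 v0 v1
  have h : (2 * μ) * (u 0 * v 1 - u 1 * v 0) = 0 := by
    linear_combination -v 1 * u0 + u 1 * v0 - u 0 * v1 + v 0 * u1
  simpa [hμ] using h

/-- A group that preserves a hyperbolic traceless matrix up to sign preserves a geodesic. -/
theorem isElementarySubgroup_of_conj_eq_or_neg {H : Subgroup PSL(2, ℝ)}
    {X : Matrix (Fin 2) (Fin 2) ℝ} (htr : X.trace = 0) (hXX : 0 < halfTraceForm X X)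
    (h : ∀ g ∈ slPreimage H, (g : Matrix (Fin 2) (Fin 2) ℝ) * X * (g⁻¹ : SL(2, ℝ)) = X ∨
      (g : Matrix (Fin 2) (Fin 2) ℝ) * X * (g⁻¹ : SL(2, ℝ)) = -X) :
    IsElementarySubgroup H := by
  have h11 : X 1 1 = -X 0 0 := by
    rw [Matrix.trace_fin_two] at htr
    linarith
  obtain ⟨μ, hμ, hμX⟩ : ∃ μ : ℝ, μ ≠ 0 ∧ μ ^ 2 = X 0 0 ^ 2 + X 0 1 * X 1 0 := by
    refine ⟨√(halfTraceForm X X), (Real.sqrt_pos.2 hXX).ne', ?_⟩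
    rw [Real.sq_sqrt hXX.le]
    simp only [halfTraceForm, Matrix.trace_fin_two, Matrix.mul_apply, Fin.sum_univ_two, h11]
    ring
  have hex : ∀ ν : ℝ, ν ^ 2 = X 0 0 ^ 2 + X 0 1 * X 1 0 →
      ∃ v : Fin 2 → ℝ, v ≠ 0 ∧ X.mulVec v = ν • v := by
    intro ν hν
    have hd : (X - ν • (1 : Matrix (Fin 2) (Fin 2) ℝ)).det = 0 := by
      rw [Matrix.det_fin_two]
      simp [h11]
      linear_combination hν
    obtain ⟨v, hv, hv'⟩ := Matrix.exists_mulVec_eq_zero_iff.2 hd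
    refine ⟨v, hv, ?_⟩
    rwa [Matrix.sub_mulVec, Matrix.smul_mulVec, Matrix.one_mulVec, sub_eq_zero] at hv'
  obtain ⟨v, hv, hvX⟩ := hex μ hμX
  obtain ⟨w, hw, hwX⟩ := hex (-μ) (by rw [neg_sq, hμX])
  refine Or.inr (Or.inr ⟨Projectivization.mk ℝ v hv, Projectivization.mk ℝ w hw, ?_,
    forall_mem_of_slPreimage fun g hg => ?_⟩)
  · rw [Ne, Projectivization.mk_eq_mk_iff']
    rintro ⟨a, rfl⟩
    rw [Matrix.mulVec_smul, hwX] at hvX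
    refine hv (funext fun i => ?_)
    have h2 := congrFun hvX i
    simp only [Pi.smul_apply, smul_eq_mul] at h2
    have h3 : (2 * μ) * (a * w i) = 0 := by linear_combination -h2
    simpa [hμ] using h3
  · have hgg : ∀ u : Fin 2 → ℝ, (g : Matrix (Fin 2) (Fin 2) ℝ).mulVec (X.mulVec u) =
        ((g : Matrix (Fin 2) (Fin 2) ℝ) * X * (g⁻¹ : SL(2, ℝ))).mulVec
          ((g : Matrix (Fin 2) (Fin 2) ℝ).mulVec u) := by
      intro u
      rw [Matrix.mulVec_mulVec, Matrix.mulVec_mulVec, mul_assoc,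
        ← Matrix.SpecialLinearGroup.coe_mul, inv_mul_cancel, Matrix.SpecialLinearGroup.coe_one,
        mul_one]
    have hv1 := hgg v
    have hw1 := hgg w
    rw [hvX, Matrix.mulVec_smul] at hv1
    rw [hwX, Matrix.mulVec_smul] at hw1
    rw [psl_smul_mk g hv (g.mulVec_ne_zero hv), psl_smul_mk g hw (g.mulVec_ne_zero hw)]
    rcases h g hg with hgX | hgX
    · rw [hgX] at hv1 hw1
      rw [(Projectivization.mk_eq_mk_iff_fin_two _ hv).2
        (mulVec_eigenvector_unique htr hμ hv1.symm hvX),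
        (Projectivization.mk_eq_mk_iff_fin_two _ hw).2
        (mulVec_eigenvector_unique htr (neg_ne_zero.2 hμ) hw1.symm hwX)]
    · rw [hgX, Matrix.neg_mulVec, eq_comm, neg_eq_iff_eq_neg, ← neg_smul] at hv1 hw1
      rw [neg_neg] at hw1
      rw [(Projectivization.mk_eq_mk_iff_fin_two _ hw).2
        (mulVec_eigenvector_unique htr (neg_ne_zero.2 hμ) hv1 hwX),
        (Projectivization.mk_eq_mk_iff_fin_two _ hv).2
        (mulVec_eigenvector_unique htr hμ hw1 hvX), Set.pair_comm]

theorem halfTraceForm_conj_conj (g : SL(2, ℝ)) (X : Matrix (Fin 2) (Fin 2) ℝ) :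
    halfTraceForm (g * X * (g⁻¹ : SL(2, ℝ))) (g * X * (g⁻¹ : SL(2, ℝ))) = halfTraceForm X X := by
  have h : ((g⁻¹ : SL(2, ℝ)) : Matrix (Fin 2) (Fin 2) ℝ) * g = 1 := by
    rw [← Matrix.SpecialLinearGroup.coe_mul, inv_mul_cancel, Matrix.SpecialLinearGroup.coe_one]
  rw [halfTraceForm, halfTraceForm, Matrix.trace_mul_comm]
  have : (g : Matrix (Fin 2) (Fin 2) ℝ) * X * (g⁻¹ : SL(2, ℝ)) * (g * X * (g⁻¹ : SL(2, ℝ))) =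
      g * (X * ((((g⁻¹ : SL(2, ℝ)) : Matrix (Fin 2) (Fin 2) ℝ) * g) * X * (g⁻¹ : SL(2, ℝ)))) := by
    simp only [mul_assoc]
  rw [this, h, one_mul, Matrix.trace_mul_comm, mul_assoc, mul_assoc, h, mul_one]

/-- A group with nontrivial elements arbitrarily close to the identity, none of which is elliptic,
is elementary. -/
theorem isElementarySubgroup_of_two_le_trace {H : Subgroup PSL(2, ℝ)}
    (hnd : ∀ U ∈ 𝓝 (1 : SL(2, ℝ)), ∃ g ∈ U, g ∈ slPreimage H ∧ g ∉ Subgroup.center SL(2, ℝ))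
    (htr : ∀ᶠ g : SL(2, ℝ) in 𝓝 1,
      g ∈ slPreimage H → 2 ≤ (g : Matrix (Fin 2) (Fin 2) ℝ).trace) :
    IsElementarySubgroup H := by
  obtain ⟨X, hX0, hX⟩ := exists_isLimitDirection hnd
  have key : ∀ Z, Z ≠ 0 → IsLimitDirection (slPreimage H) Z → halfTraceForm Z Z = 0 →
      IsElementarySubgroup H := fun Z hZ0 hZ hZZ =>
    isElementarySubgroup_of_nilpotent hZ0 hZ.trace_eq_zero hZZ fun g hg => by
      have := hZ.halfTraceForm_conj_sq htr hg
      simpa [hZZ] using this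
  rcases (hX.halfTraceForm_self_nonneg htr).eq_or_lt with h0 | hpos
  · exact key X hX0 hX h0.symm
  by_cases hall : ∀ g ∈ slPreimage H,
      (g : Matrix (Fin 2) (Fin 2) ℝ) * X * (g⁻¹ : SL(2, ℝ)) = X ∨
        (g : Matrix (Fin 2) (Fin 2) ℝ) * X * (g⁻¹ : SL(2, ℝ)) = -X
  · exact isElementarySubgroup_of_conj_eq_or_neg hX.trace_eq_zero hpos hall
  push Not at hall
  obtain ⟨g, hg, h1, h2⟩ := hall
  have hYY := halfTraceForm_conj_conj g X
  have hXY := sq_eq_sq_iff_eq_or_eq_neg.1 (hX.halfTraceForm_conj_sq htr hg)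
  have hadd := hX.add_conj hg
  -- Since the two vectors have equal norm and pairing plus or minus that norm, their difference or
  -- sum is a nonzero null limit direction, which reduces to the nilpotent case.
  have hsub := hX.sub_conj hg
  generalize (g : Matrix (Fin 2) (Fin 2) ℝ) * X * (g⁻¹ : SL(2, ℝ)) = Y at *
  have hYX : halfTraceForm Y X = halfTraceForm X Y := by
    rw [halfTraceForm, Matrix.trace_mul_comm, halfTraceForm]
  rcases hXY with hXY | hXY
  · refine key (X - Y) (sub_ne_zero.2 h1.symm) hsub ?_
    have : halfTraceForm (X - Y) (X - Y) =
        halfTraceForm X X - halfTraceForm X Y - halfTraceForm Y X + halfTraceForm Y Y := by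
      simp only [halfTraceForm, sub_mul, mul_sub, Matrix.trace_sub]
      ring
    rw [this, hYX, hYY, hXY]
    ring
  · refine key (X + Y) (fun h => h2 (eq_neg_of_add_eq_zero_right h)) hadd ?_
    have : halfTraceForm (X + Y) (X + Y) =
        halfTraceForm X X + halfTraceForm X Y + halfTraceForm Y X + halfTraceForm Y Y := by
      simp only [halfTraceForm, add_mul, mul_add, Matrix.trace_add]
      ring
    rw [this, hYX, hYY, hXY]
    ring

end Elementary

/-! ### Existence of an elliptic element of infinite order -/

section Elliptic

open Filter

/-- An elliptic matrix of determinant one lies in a subalgebra isomorphic to `ℂ`, where it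
corresponds to a non-real number of absolute value one. -/
theorem exists_complex_algHom_of_trace_lt {g : SL(2, ℝ)}
    (hg : (g : Matrix (Fin 2) (Fin 2) ℝ).trace ^ 2 < 4) :
    ∃ (φ : ℂ →ₐ[ℝ] Matrix (Fin 2) (Fin 2) ℝ) (μ : ℂ), φ μ = g ∧ ‖μ‖ = 1 ∧ μ.im ≠ 0 ∧
      μ + μ⁻¹ = ((g : Matrix (Fin 2) (Fin 2) ℝ).trace : ℂ) := by
  set t := (g : Matrix (Fin 2) (Fin 2) ℝ).trace with ht
  set s := √(1 - t ^ 2 / 4) with hs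
  have hs2 : s ^ 2 = 1 - t ^ 2 / 4 := Real.sq_sqrt (by linarith)
  have hs0 : s ≠ 0 := (Real.sqrt_pos.2 (by linarith)).ne'
  have hd := g.det_coe
  rw [Matrix.det_fin_two] at hd
  have hX : tracelessPart g * tracelessPart g = -(s ^ 2) • (1 : Matrix (Fin 2) (Fin 2) ℝ) := by
    rw [hs2, ht]
    ext i j
    fin_cases i <;> fin_cases j <;>
      simp [tracelessPart, Matrix.trace_fin_two, Matrix.mul_apply] <;>
      first | ring1 | linear_combination -hd
  -- The normalised traceless part plays the role of `i`; the trace is `2 cos θ` and `s` is `|sin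
  -- θ|`.
  have hJ : (s⁻¹ • tracelessPart g) * (s⁻¹ • tracelessPart g) = -1 := by
    rw [smul_mul_smul_comm, hX, smul_smul]
    have : s⁻¹ * s⁻¹ * -s ^ 2 = -1 := by field_simp
    rw [this, neg_one_smul]
  have hn : ‖(⟨t / 2, s⟩ : ℂ)‖ = 1 := by
    rw [← sq_eq_sq₀ (norm_nonneg _) zero_le_one, ← Complex.normSq_eq_norm_sq, Complex.normSq_mk]
    linear_combination hs2
  refine ⟨Complex.lift ⟨s⁻¹ • tracelessPart g, hJ⟩, ⟨t / 2, s⟩, ?_, hn, hs0, ?_⟩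
  · rw [Complex.lift_apply, Complex.liftAux_apply, smul_smul, mul_inv_cancel₀ hs0, one_smul,
      tracelessPart, Algebra.algebraMap_eq_smul_one]
    abel
  · rw [Complex.inv_eq_conj hn]
    apply Complex.ext <;> simp

theorem pow_two_mul_eq_one_of_mem_center {g : SL(2, ℝ)} {n : ℕ}
    (hg : g ^ n ∈ Subgroup.center SL(2, ℝ)) : g ^ (2 * n) = 1 := by
  rw [mul_comm, pow_mul]
  obtain ⟨r, hr, hrg⟩ := Matrix.SpecialLinearGroup.mem_center_iff.1 hg
  rw [Fintype.card_fin] at hr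
  ext i j
  rw [Matrix.SpecialLinearGroup.coe_pow, ← hrg, ← map_pow, hr, map_one,
    Matrix.SpecialLinearGroup.coe_one]

theorem isEllipticPSL_mk {g : SL(2, ℝ)}
    (hg : (g : Matrix (Fin 2) (Fin 2) ℝ).trace ^ 2 < 4) : IsEllipticPSL (g : PSL(2, ℝ)) := by
  refine ⟨g, rfl, ?_⟩
  rw [Matrix.IsElliptic, Matrix.discr_fin_two, g.det_coe]
  linarith

theorem trace_sq_lt_of_isElliptic {g : SL(2, ℝ)}
    (hg : (g : Matrix (Fin 2) (Fin 2) ℝ).IsElliptic) :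
    (g : Matrix (Fin 2) (Fin 2) ℝ).trace ^ 2 < 4 := by
  rw [Matrix.IsElliptic, Matrix.discr_fin_two, g.det_coe] at hg
  linarith

/-- The traces of a finitely generated group lie in a finitely generated field. -/
theorem exists_finite_trace_mem_adjoin {H : Subgroup PSL(2, ℝ)} (hfg : H.FG) :
    ∃ S : Set ℝ, S.Finite ∧ ∀ g ∈ slPreimage H,
      (g : Matrix (Fin 2) (Fin 2) ℝ).trace ∈ IntermediateField.adjoin ℚ S := by
  obtain ⟨T, rfl⟩ := hfg
  choose f hf using fun p : PSL(2, ℝ) => QuotientGroup.mk_surjective p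
  let S : Set ℝ := ⋃ p ∈ T, Set.range fun ij : Fin 2 × Fin 2 => f p ij.1 ij.2
  have hS : S.Finite := T.finite_toSet.biUnion fun p _ => Set.finite_range _
  refine ⟨S, hS, ?_⟩
  set K := IntermediateField.adjoin ℚ S
  let R : Subgroup PSL(2, ℝ) :=
    (Matrix.SpecialLinearGroup.map (n := Fin 2) (algebraMap K ℝ)).range.map
      (QuotientGroup.mk' (Subgroup.center SL(2, ℝ)))
  have hR : Subgroup.closure (T : Set PSL(2, ℝ)) ≤ R := by
    rw [Subgroup.closure_le]
    intro p hp
    have hmem : ∀ i j, f p i j ∈ K := fun i j =>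
      IntermediateField.subset_adjoin _ _ (Set.mem_iUnion₂.2 ⟨p, hp, ⟨(i, j), rfl⟩⟩)
    let A : Matrix (Fin 2) (Fin 2) K := fun i j => ⟨f p i j, hmem i j⟩
    have hA : A.det = 1 := by
      apply (algebraMap K ℝ).injective
      have hd := (f p).det_coe
      rw [Matrix.det_fin_two] at hd ⊢
      rw [map_one, ← hd]
      rfl
    exact ⟨f p, ⟨⟨A, hA⟩, by ext i j; rfl⟩, hf p⟩
  intro g hg
  obtain ⟨_, ⟨A, rfl⟩, hA⟩ := hR (mem_slPreimage.1 hg)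
  have hA' := QuotientGroup.eq.1 hA
  obtain ⟨r, hr, hrg⟩ := Matrix.SpecialLinearGroup.mem_center_iff.1 hA'
  have hgA : g = Matrix.SpecialLinearGroup.map (n := Fin 2) (algebraMap K ℝ) A *
      ((Matrix.SpecialLinearGroup.map (n := Fin 2) (algebraMap K ℝ) A)⁻¹ * g) := by group
  -- Chosen lifts of the generators have entries in `K`; another lift of the same element differs
  -- only by the sign `r`.
  have htr : (g : Matrix (Fin 2) (Fin 2) ℝ).trace =
      r * algebraMap K ℝ (A : Matrix (Fin 2) (Fin 2) K).trace := by
    rw [hgA, Matrix.SpecialLinearGroup.coe_mul, ← hrg]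
    simp [Matrix.trace_fin_two]
    ring
  rw [htr]
  refine mul_mem ?_ (A : Matrix (Fin 2) (Fin 2) K).trace.2
  rw [Fintype.card_fin] at hr
  rcases sq_eq_one_iff.1 hr with rfl | rfl
  · exact one_mem K
  · exact neg_mem (one_mem K)

theorem exists_nontrivial_mem_of_not_discrete {H : Subgroup PSL(2, ℝ)}
    (hnd : ¬ DiscreteTopology H) :
    ∀ U ∈ 𝓝 (1 : SL(2, ℝ)), ∃ g ∈ U, g ∈ slPreimage H ∧ g ∉ Subgroup.center SL(2, ℝ) := by
  intro U hU
  by_contra! hcon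
  refine hnd (discreteTopology_of_isOpen_singleton_one ?_)
  have hV : (QuotientGroup.mk '' U : Set PSL(2, ℝ)) ∈ 𝓝 (1 : PSL(2, ℝ)) :=
    (QuotientGroup.isOpenMap_coe (N := Subgroup.center SL(2, ℝ))).image_mem_nhds hU
  rw [isOpen_singleton_iff_nhds_eq_pure, nhds_subtype_eq_comap]
  refine le_antisymm (Filter.le_pure_iff.2 ⟨_, hV, ?_⟩) ?_
  · rintro ⟨p, hp⟩ ⟨g, hgU, hg⟩
    have hgp : (g : PSL(2, ℝ)) = p := hg
    have h1 : g ∈ Subgroup.center SL(2, ℝ) :=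
      hcon g hgU (mem_slPreimage.2 (hgp ▸ hp))
    exact Subtype.ext (hgp.symm.trans ((QuotientGroup.eq_one_iff g).2 h1))
  · rw [← nhds_subtype_eq_comap]
    exact pure_le_nhds _

/-- A finitely generated non-elementary non-discrete subgroup of `PSL(2, ℝ)` contains an elliptic
element of infinite order. -/
theorem exists_isEllipticPSL_not_isOfFinOrder {H : Subgroup PSL(2, ℝ)} (hfg : H.FG)
    (hne : ¬ IsElementarySubgroup H) (hnd : ¬ DiscreteTopology H) :
    ∃ α ∈ H, IsEllipticPSL α ∧ ¬ IsOfFinOrder α := by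
  by_contra! hcon
  obtain ⟨S, hS, hSH⟩ := exists_finite_trace_mem_adjoin hfg
  have hfin := finite_rootOfUnity_traces hS
  refine hne (isElementarySubgroup_of_two_le_trace (exists_nontrivial_mem_of_not_discrete hnd) ?_)
  have hcont : Continuous fun g : SL(2, ℝ) => (g : Matrix (Fin 2) (Fin 2) ℝ).trace :=
    (continuous_id.matrix_trace).comp continuous_subtype_val
  have h1 : (1 : SL(2, ℝ)).1.trace = 2 := by simp
  -- The value 2 itself, from `ζ = 1`, must be removed before the finite set avoids a neighbourhood
  -- of the trace of the identity.
  have hclosed := (hfin.subset (Set.sdiff_subset (t := {2}))).isClosed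
  have e1 := (hcont.tendsto 1).eventually (hclosed.isOpen_compl.mem_nhds (x := _) (by simp))
  have e2 := (hcont.tendsto 1).eventually (lt_mem_nhds (a := -2) (by norm_num))
  filter_upwards [e1, e2] with g hg1 hg2 hgH
  by_contra! hlt
  have hlt4 : (g : Matrix (Fin 2) (Fin 2) ℝ).trace ^ 2 < 4 := by nlinarith
  obtain ⟨n, hn, hgn⟩ := (isOfFinOrder_iff_pow_eq_one).1
    (hcon _ (mem_slPreimage.1 hgH) (isEllipticPSL_mk hlt4))
  have hg2n : g ^ (2 * n) = 1 := pow_two_mul_eq_one_of_mem_center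
    ((QuotientGroup.eq_one_iff (N := Subgroup.center SL(2, ℝ)) (g ^ n)).1 hgn)
  obtain ⟨φ, μ, hφ, -, -, hμ⟩ := exists_complex_algHom_of_trace_lt hlt4
  refine hg1 ⟨⟨hSH g hgH, μ, 2 * n, by omega, ?_, hμ.symm⟩, hlt.ne⟩
  apply φ.toRingHom.injective
  change φ (μ ^ (2 * n)) = φ 1
  rw [map_pow, hφ, map_one, ← Matrix.SpecialLinearGroup.coe_pow, hg2n,
    Matrix.SpecialLinearGroup.coe_one]

end Elliptic

/-! ### Ping-pong over a normed field -/

section PingPong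

open Filter
open scoped Pointwise

/-- The determinant of two plane vectors. -/
def planeDet {k : Type*} [CommRing k] (u v : Fin 2 → k) : k := u 0 * v 1 - u 1 * v 0

theorem planeDet_mulVec {k : Type*} [CommRing k] (g : SL(2, k)) (u v : Fin 2 → k) :
    planeDet ((g : Matrix (Fin 2) (Fin 2) k).mulVec u)
      ((g : Matrix (Fin 2) (Fin 2) k).mulVec v) = planeDet u v := by
  have hd := g.det_coe
  rw [Matrix.det_fin_two] at hd
  simp only [planeDet, Matrix.mulVec, dotProduct, Fin.sum_univ_two]
  linear_combination (u 0 * v 1 - u 1 * v 0) * hd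

theorem planeDet_smul_left {k : Type*} [CommRing k] (c : k) (u v : Fin 2 → k) :
    planeDet (c • u) v = c * planeDet u v := by
  simp only [planeDet, Pi.smul_apply, smul_eq_mul]
  ring

theorem planeDet_swap {k : Type*} [CommRing k] (u v : Fin 2 → k) :
    planeDet v u = -planeDet u v := by
  simp only [planeDet]
  ring

theorem planeDet_self {k : Type*} [CommRing k] (u : Fin 2 → k) : planeDet u u = 0 := by
  simp only [planeDet]
  ring

/-- The Plücker relation, used to bound any `planeDet u' x` by the coordinates of `x` relative to
`u` and `w`. -/
theorem planeDet_expand {k : Type*} [CommRing k] (u w u' x : Fin 2 → k) :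
    planeDet u w * planeDet u' x = planeDet u' w * planeDet u x + planeDet u u' * planeDet w x := by
  simp only [planeDet]
  ring

theorem eq_zero_of_planeDet_eq_zero {k : Type*} [Field k] {u w x : Fin 2 → k}
    (h : planeDet u w ≠ 0) (hu : planeDet u x = 0) (hw : planeDet w x = 0) : x = 0 := by
  have h0 : planeDet u w * x 0 = 0 := by
    simp only [planeDet] at *
    linear_combination w 0 * hu - u 0 * hw
  have h1 : planeDet u w * x 1 = 0 := by
    simp only [planeDet] at *
    linear_combination w 1 * hu - u 1 * hw
  ext i
  fin_cases i
  · simpa [h] using h0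
  · simpa [h] using h1

theorem planeDet_pow_mulVec {k : Type*} [Field k] {A : SL(2, k)} {μ : k} (hμ : μ ≠ 0)
    {v : Fin 2 → k} (hv : (A : Matrix (Fin 2) (Fin 2) k).mulVec v = μ • v) (n : ℕ)
    (x : Fin 2 → k) :
    planeDet v (((A ^ n : SL(2, k)) : Matrix (Fin 2) (Fin 2) k).mulVec x) =
      (μ⁻¹) ^ n * planeDet v x := by
  induction n with
  | zero => simp
  | succ n ih =>
    have h := planeDet_mulVec A v
      (((A ^ n : SL(2, k)) : Matrix (Fin 2) (Fin 2) k).mulVec x)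
    rw [hv, planeDet_smul_left, Matrix.mulVec_mulVec, ← Matrix.SpecialLinearGroup.coe_mul,
      ← pow_succ', ih] at h
    rw [pow_succ' μ⁻¹, mul_assoc, ← h, ← mul_assoc, inv_mul_cancel₀ hμ, one_mul]

/-- The action of `SL(2, k)` on nonzero vectors. -/
abbrev nonzeroVectorAction (k : Type*) [Field k] : MulAction SL(2, k) {x : Fin 2 → k // x ≠ 0} where
  smul g x := ⟨(g : Matrix (Fin 2) (Fin 2) k).mulVec x, g.mulVec_ne_zero x.2⟩
  one_smul x := Subtype.ext (by
    change ((1 : SL(2, k)) : Matrix (Fin 2) (Fin 2) k).mulVec x = x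
    simp)
  mul_smul g h x := Subtype.ext (by
    change ((g * h : SL(2, k)) : Matrix (Fin 2) (Fin 2) k).mulVec x =
      (g : Matrix (Fin 2) (Fin 2) k).mulVec ((h : Matrix (Fin 2) (Fin 2) k).mulVec x)
    rw [Matrix.mulVec_mulVec, Matrix.SpecialLinearGroup.coe_mul])

variable {k : Type} [NormedField k]

/-- The cone of nonzero vectors that are close to the line spanned by `u`, as measured against the
line spanned by `v`. -/
def vectorCone (C : ℝ) (u v : Fin 2 → k) : Set {x : Fin 2 → k // x ≠ 0} :=
  {x | C * ‖planeDet u x‖ < ‖planeDet v x‖}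

theorem vectorCone_nonempty (C : ℝ) {u v : Fin 2 → k} (h : planeDet u v ≠ 0) :
    (vectorCone C u v).Nonempty := by
  refine ⟨⟨u, ?_⟩, ?_⟩
  · rintro rfl
    simp [planeDet] at h
  · change C * ‖planeDet u u‖ < ‖planeDet v u‖
    rw [planeDet_self, norm_zero, mul_zero, planeDet_swap, norm_neg]
    exact norm_pos_iff.2 h

theorem eventually_disjoint_vectorCone {u w : Fin 2 → k} (h : planeDet u w ≠ 0)
    (u' w' : Fin 2 → k) : ∀ᶠ C : ℝ in atTop, Disjoint (vectorCone C u u') (vectorCone C w w') := by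
  let D := ‖planeDet u w‖
  have hD : 0 < D := norm_pos_iff.2 h
  let M := ‖planeDet u' w‖ + ‖planeDet u u'‖ + ‖planeDet w' w‖ + ‖planeDet u w'‖
  have hbd : ∀ z x : Fin 2 → k, ‖planeDet z w‖ ≤ M → ‖planeDet u z‖ ≤ M →
      D * ‖planeDet z x‖ ≤ M * (‖planeDet u x‖ + ‖planeDet w x‖) := by
    intro z x h1 h2
    rw [← norm_mul, planeDet_expand, mul_add]
    refine (norm_add_le _ _).trans ?_
    rw [norm_mul, norm_mul]
    gcongr
  -- A common vector would satisfy both cone inequalities; adding them and applying `hbd` twice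
  -- gives `C * D < 2 * M`.
  filter_upwards [eventually_ge_atTop (2 * M / D)] with C hC
  rw [Set.disjoint_left]
  rintro ⟨x, hx⟩ (hx1 : C * ‖planeDet u x‖ < ‖planeDet u' x‖)
    (hx2 : C * ‖planeDet w x‖ < ‖planeDet w' x‖)
  have hM : ∀ {a b c d : ℝ}, 0 ≤ a → 0 ≤ b → 0 ≤ c → 0 ≤ d →
      a ≤ a + b + c + d ∧ b ≤ a + b + c + d ∧ c ≤ a + b + c + d ∧ d ≤ a + b + c + d := by
    intro a b c d h1 h2 h3 h4
    refine ⟨?_, ?_, ?_, ?_⟩ <;> linarith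
  obtain ⟨m1, m2, m3, m4⟩ := hM (norm_nonneg (planeDet u' w)) (norm_nonneg (planeDet u u'))
    (norm_nonneg (planeDet w' w)) (norm_nonneg (planeDet u w'))
  have b1 := hbd u' x m1 m2
  have b2 := hbd w' x m3 m4
  have hC' : 2 * M ≤ C * D := (div_le_iff₀ hD).1 hC
  have h1 := mul_lt_mul_of_pos_left hx1 hD
  have h2 := mul_lt_mul_of_pos_left hx2 hD
  have h3 := mul_le_mul_of_nonneg_right hC'
    (add_nonneg (norm_nonneg (planeDet u x)) (norm_nonneg (planeDet w x)))
  nlinarith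

/-- The ratio of the two determinants changes by `‖μ‖ ^ (2 * n)`, more than the factor `C ^ 2`
separating the complement of the repelling cone from the attracting cone. -/
theorem pow_mulVec_mem_vectorCone {A : SL(2, k)} {μ : k} (hμ : μ ≠ 0) {u v : Fin 2 → k}
    (hu : (A : Matrix (Fin 2) (Fin 2) k).mulVec u = μ • u)
    (hv : (A : Matrix (Fin 2) (Fin 2) k).mulVec v = μ⁻¹ • v) (huv : planeDet u v ≠ 0)
    {C : ℝ} (hC : 1 ≤ C) {n : ℕ} (hn : C < ‖μ‖ ^ n) {x : Fin 2 → k} (hx : x ≠ 0)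
    (hxC : ‖planeDet u x‖ ≤ C * ‖planeDet v x‖) :
    C * ‖planeDet u (((A ^ n : SL(2, k)) : Matrix (Fin 2) (Fin 2) k).mulVec x)‖ <
      ‖planeDet v (((A ^ n : SL(2, k)) : Matrix (Fin 2) (Fin 2) k).mulVec x)‖ := by
  rw [planeDet_pow_mulVec hμ hu, planeDet_pow_mulVec (inv_ne_zero hμ) hv, inv_inv, norm_mul,
    norm_mul, norm_pow, norm_pow, norm_inv, inv_pow]
  have hpos : 0 < ‖planeDet v x‖ := by
    rw [norm_pos_iff]
    intro h0
    rw [h0, norm_zero, mul_zero, norm_le_zero_iff] at hxC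
    exact hx (eq_zero_of_planeDet_eq_zero huv hxC h0)
  have hP : 0 < ‖μ‖ ^ n := by linarith
  rw [inv_mul_eq_div, ← mul_div_assoc, div_lt_iff₀ hP]
  calc C * ‖planeDet u x‖ ≤ C * (C * ‖planeDet v x‖) := by gcongr
    _ = C * C * ‖planeDet v x‖ := by ring
    _ < ‖μ‖ ^ n * ‖μ‖ ^ n * ‖planeDet v x‖ := by gcongr
    _ = _ := by ring

/-- High powers of two matrices over a normed field, both diagonalizable with an eigenvalue of
absolute value greater than one and without common eigenlines, generate a free group. -/
theorem eventually_injective_lift_pow {A B : SL(2, k)} {μ : k} (hμ : 1 < ‖μ‖)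
    {u v w z : Fin 2 → k}
    (hu : (A : Matrix (Fin 2) (Fin 2) k).mulVec u = μ • u)
    (hv : (A : Matrix (Fin 2) (Fin 2) k).mulVec v = μ⁻¹ • v)
    (hw : (B : Matrix (Fin 2) (Fin 2) k).mulVec w = μ • w)
    (hz : (B : Matrix (Fin 2) (Fin 2) k).mulVec z = μ⁻¹ • z)
    (huv : planeDet u v ≠ 0) (hwz : planeDet w z ≠ 0) (huw : planeDet u w ≠ 0)
    (huz : planeDet u z ≠ 0) (hvw : planeDet v w ≠ 0) (hvz : planeDet v z ≠ 0) :
    ∃ N : ℕ, ∀ p q, N ≤ p → N ≤ q →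
      Function.Injective (FreeGroup.lift (![A ^ p, B ^ q] : Fin 2 → SL(2, k))) := by
  have hμ0 : μ ≠ 0 := norm_pos_iff.1 (zero_lt_one.trans hμ)
  obtain ⟨C, hC, d1, d2, d3, d4, d5, d6⟩ := ((eventually_ge_atTop (1 : ℝ)).and
    ((eventually_disjoint_vectorCone huv v u).and
    ((eventually_disjoint_vectorCone hwz z w).and
    ((eventually_disjoint_vectorCone huw v z).and
    ((eventually_disjoint_vectorCone huz v w).and
    ((eventually_disjoint_vectorCone hvw u z).and
    (eventually_disjoint_vectorCone hvz u w))))))).exists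
  obtain ⟨N, hN⟩ := pow_unbounded_of_one_lt C hμ
  refine ⟨N, fun p q hp hq => ?_⟩
  have hpC : C < ‖μ‖ ^ p := hN.trans_le (pow_le_pow_right₀ hμ.le hp)
  have hqC : C < ‖μ‖ ^ q := hN.trans_le (pow_le_pow_right₀ hμ.le hq)
  let := nonzeroVectorAction k
  have hinv : ∀ {D : SL(2, k)} {ν : k} {y : Fin 2 → k}, ν ≠ 0 →
      (D : Matrix (Fin 2) (Fin 2) k).mulVec y = ν • y →
      ((D⁻¹ : SL(2, k)) : Matrix (Fin 2) (Fin 2) k).mulVec y = ν⁻¹ • y := by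
    intro D ν y hν h
    have h1 : ((D⁻¹ : SL(2, k)) : Matrix (Fin 2) (Fin 2) k).mulVec
        ((D : Matrix (Fin 2) (Fin 2) k).mulVec y) = y := by
      rw [Matrix.mulVec_mulVec, ← Matrix.SpecialLinearGroup.coe_mul, inv_mul_cancel,
        Matrix.SpecialLinearGroup.coe_one, Matrix.one_mulVec]
    rw [h, Matrix.mulVec_smul] at h1
    rw [← h1, smul_smul, inv_mul_cancel₀ hν, one_smul, h1]
  have hmem : ∀ {D : SL(2, k)} {y y' : Fin 2 → k} {n : ℕ},
      (D : Matrix (Fin 2) (Fin 2) k).mulVec y = μ • y →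
      (D : Matrix (Fin 2) (Fin 2) k).mulVec y' = μ⁻¹ • y' → planeDet y y' ≠ 0 →
      C < ‖μ‖ ^ n → D ^ n • (vectorCone C y' y)ᶜ ⊆ vectorCone C y y' := by
    rintro D y y' n hy hy' hyy hn _ ⟨⟨x, hx⟩, hxC, rfl⟩
    exact pow_mulVec_mem_vectorCone hμ0 hy hy' hyy hC hn hx (not_lt.1 hxC)
  have hmem' : ∀ {D : SL(2, k)} {y y' : Fin 2 → k} {n : ℕ},
      (D : Matrix (Fin 2) (Fin 2) k).mulVec y = μ • y →
      (D : Matrix (Fin 2) (Fin 2) k).mulVec y' = μ⁻¹ • y' → planeDet y y' ≠ 0 →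
      C < ‖μ‖ ^ n → (D ^ n)⁻¹ • (vectorCone C y y')ᶜ ⊆ vectorCone C y' y := by
    intro D y y' n hy hy' hyy hn
    rw [← inv_pow]
    refine hmem (by simpa using hinv (inv_ne_zero hμ0) hy') (hinv hμ0 hy) ?_ hn
    rw [planeDet_swap]
    exact neg_ne_zero.2 hyy
  have hvu : planeDet v u ≠ 0 := by rw [planeDet_swap]; exact neg_ne_zero.2 huv
  have hzw : planeDet z w ≠ 0 := by rw [planeDet_swap]; exact neg_ne_zero.2 hwz
  refine FreeGroup.injective_lift_of_ping_pong (![A ^ p, B ^ q] : Fin 2 → SL(2, k))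
    ![vectorCone C u v, vectorCone C w z] ![vectorCone C v u, vectorCone C z w] ?_ ?_ ?_ ?_ ?_ ?_
  · intro i
    fin_cases i
    · exact vectorCone_nonempty C huv
    · exact vectorCone_nonempty C hwz
  · intro i j hij
    fin_cases i <;> fin_cases j
    · exact absurd rfl hij
    · exact d3
    · exact d3.symm
    · exact absurd rfl hij
  · intro i j hij
    fin_cases i <;> fin_cases j
    · exact absurd rfl hij
    · exact d6
    · exact d6.symm
    · exact absurd rfl hij
  · intro i j
    fin_cases i <;> fin_cases j
    · exact d1
    · exact d4
    · exact d5.symm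
    · exact d2
  · intro i
    fin_cases i
    · exact hmem hu hv huv hpC
    · exact hmem hw hz hwz hqC
  · intro i
    fin_cases i
    · exact hmem' hu hv huv hpC
    · exact hmem' hw hz hwz hqC

/-- High powers of two matrices over a normed field, both diagonalizable with an eigenvalue off the
unit circle and without common eigenlines, generate a free group. -/
theorem eventually_injective_lift_pow_of_norm_ne_one {A B : SL(2, k)} {μ : k} (hμ : ‖μ‖ ≠ 1)
    {u v w z : Fin 2 → k}
    (hu : (A : Matrix (Fin 2) (Fin 2) k).mulVec u = μ • u)
    (hv : (A : Matrix (Fin 2) (Fin 2) k).mulVec v = μ⁻¹ • v)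
    (hw : (B : Matrix (Fin 2) (Fin 2) k).mulVec w = μ • w)
    (hz : (B : Matrix (Fin 2) (Fin 2) k).mulVec z = μ⁻¹ • z)
    (huv : planeDet u v ≠ 0) (hwz : planeDet w z ≠ 0) (huw : planeDet u w ≠ 0)
    (huz : planeDet u z ≠ 0) (hvw : planeDet v w ≠ 0) (hvz : planeDet v z ≠ 0) :
    ∃ N : ℕ, ∀ p q, N ≤ p → N ≤ q →
      Function.Injective (FreeGroup.lift (![A ^ p, B ^ q] : Fin 2 → SL(2, k))) := by
  rcases hμ.lt_or_gt with h | h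
  · have hμ0 : μ ≠ 0 := by
      rintro rfl
      rw [zero_smul] at hu
      refine A.mulVec_ne_zero ?_ hu
      rintro rfl
      simp [planeDet] at huv
    have h' : 1 < ‖μ⁻¹‖ := by
      rw [norm_inv]
      exact (one_lt_inv₀ (norm_pos_iff.2 hμ0)).2 h
    exact eventually_injective_lift_pow h' hv (by rwa [inv_inv]) hz (by rwa [inv_inv])
      (by rw [planeDet_swap]; exact neg_ne_zero.2 huv)
      (by rw [planeDet_swap]; exact neg_ne_zero.2 hwz) hvz hvw huz huw
  · exact eventually_injective_lift_pow h hu hv hw hz huv hwz huw huz hvw hvz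

end PingPong

/-! ### Recurrence, transfer of freeness, and the conclusion -/

section Conclusion

open Filter

theorem frequently_pow_mem_nhds_one {g : SL(2, ℝ)}
    (hg : (g : Matrix (Fin 2) (Fin 2) ℝ).trace ^ 2 < 4) {U : Set PSL(2, ℝ)}
    (hU : U ∈ 𝓝 (1 : PSL(2, ℝ))) : ∃ᶠ n : ℕ in atTop, (g : PSL(2, ℝ)) ^ n ∈ U := by
  obtain ⟨φ, μ, hφ, hμ, -, -⟩ := exists_complex_algHom_of_trace_lt hg
  have hV : (QuotientGroup.mk : SL(2, ℝ) → PSL(2, ℝ)) ⁻¹' U ∈ 𝓝 (1 : SL(2, ℝ)) :=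
    QuotientGroup.continuous_mk.continuousAt.preimage_mem_nhds hU
  obtain ⟨W, hW, hWU⟩ := mem_nhds_induced (Subtype.val : SL(2, ℝ) → Matrix (Fin 2) (Fin 2) ℝ) _ _
    |>.1 hV
  have hφc : Continuous φ := φ.toLinearMap.continuous_of_finiteDimensional
  let x : Circle := ⟨μ, mem_sphere_zero_iff_norm.2 hμ⟩
  have hF : Continuous fun y : Circle => φ y := hφc.comp continuous_subtype_val
  -- Powers of a point of the compact group `Circle` accumulate at 1.
  have hx := (mapClusterPt_one_atTop_pow x).frequently (hF.continuousAt.preimage_mem_nhds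
    (x := 1) (t := W) (by simpa using hW))
  refine hx.mono fun n hn => ?_
  refine hWU (a := g ^ n) ?_
  change ((g ^ n : SL(2, ℝ)) : Matrix (Fin 2) (Fin 2) ℝ) ∈ W
  have hn' : φ ((x ^ n : Circle) : ℂ) ∈ W := hn
  rwa [Circle.coe_pow, map_pow, show φ (x : ℂ) = g from hφ,
    ← Matrix.SpecialLinearGroup.coe_pow] at hn'

/-- Freeness in `PSL(2, ℝ)` can be tested after a change of coefficients. -/
theorem freelyGenerate_of_injective_map {k : Type} [Field k] (σ : ℝ →+* k) {a b : SL(2, ℝ)}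
    (h : Function.Injective (FreeGroup.lift
      (![Matrix.SpecialLinearGroup.map (n := Fin 2) σ a,
        Matrix.SpecialLinearGroup.map (n := Fin 2) σ b] : Fin 2 → SL(2, k)))) :
    FreelyGenerate (a : PSL(2, ℝ)) (b : PSL(2, ℝ)) := by
  let Φ : FreeGroup (Fin 2) →* SL(2, ℝ) := FreeGroup.lift ![a, b]
  have h1 : FreeGroup.lift (![(a : PSL(2, ℝ)), (b : PSL(2, ℝ))] : Fin 2 → PSL(2, ℝ)) =
      (QuotientGroup.mk' (Subgroup.center SL(2, ℝ))).comp Φ := by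
    ext i
    fin_cases i <;> simp [Φ]
  have h2 : FreeGroup.lift (![Matrix.SpecialLinearGroup.map (n := Fin 2) σ a,
      Matrix.SpecialLinearGroup.map (n := Fin 2) σ b] : Fin 2 → SL(2, k)) =
      (Matrix.SpecialLinearGroup.map (n := Fin 2) σ).comp Φ := by
    refine FreeGroup.ext_hom _ _ fun i => ?_
    fin_cases i <;> simp [Φ]
  rw [h2] at h
  rw [FreelyGenerate, h1, injective_iff_map_eq_one]
  intro w hw
  have hc : Φ w ^ 1 ∈ Subgroup.center SL(2, ℝ) := by
    rw [pow_one]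
    exact (QuotientGroup.eq_one_iff (N := Subgroup.center SL(2, ℝ)) (Φ w)).1 hw
  -- A word trivial in the quotient is central, so its square is trivial in `SL(2, ℝ)`; free groups
  -- have no torsion.
  have hw2 : w ^ 2 = 1 := by
    apply h
    rw [map_one, MonoidHom.comp_apply, map_pow, pow_two_mul_eq_one_of_mem_center hc, map_one]
  exact (pow_eq_one_iff_left two_ne_zero).1 hw2

/-- A real matrix of determinant one with a non-real eigenvalue has a fixed point in the upper
half-plane, which is the eigenline of one of the two eigenvalues. -/
theorem exists_upperHalfPlane_eigenvector {g : SL(2, ℝ)} {μ : ℂ} (hμ0 : ‖μ‖ = 1) (hμ : μ.im ≠ 0)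
    (htr : μ + μ⁻¹ = ((g : Matrix (Fin 2) (Fin 2) ℝ).trace : ℂ)) :
    ∃ (z : UpperHalfPlane) (ν : ℂ), (ν = μ ∨ ν = μ⁻¹) ∧
      (g 0 0 * z + g 0 1 : ℂ) = ν * z ∧ (g 1 0 * z + g 1 1 : ℂ) = ν := by
  have hd : (g 0 0 * g 1 1 - g 0 1 * g 1 0 : ℂ) = 1 := by
    have hd := g.det_coe
    rw [Matrix.det_fin_two] at hd
    exact_mod_cast hd
  have hm0 : μ ≠ 0 := norm_pos_iff.1 (hμ0 ▸ zero_lt_one)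
  rw [Matrix.trace_fin_two] at htr
  push_cast at htr
  have hroot : ∀ ν : ℂ, ν = μ ∨ ν = μ⁻¹ → ν ^ 2 - (g 0 0 + g 1 1) * ν + 1 = 0 := by
    rintro ν (rfl | rfl)
    · rw [← htr]
      field_simp
      ring
    · rw [← htr]
      field_simp
      ring
  -- Otherwise `g` is triangular and its eigenvalues are real.
  have hc : (g 1 0 : ℝ) ≠ 0 := by
    intro hc
    have h := hroot μ (Or.inl rfl)
    have h2 : (μ - (g 0 0 : ℝ)) * (μ - (g 1 1 : ℝ)) = 0 := by
      rw [hc] at hd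
      push_cast at hd
      linear_combination h + hd
    rcases mul_eq_zero.1 h2 with h3 | h3
    · rw [sub_eq_zero.1 h3] at hμ
      simp at hμ
    · rw [sub_eq_zero.1 h3] at hμ
      simp at hμ
  have hcC : (g 1 0 : ℂ) ≠ 0 := by exact_mod_cast hc
  obtain ⟨ν, hν, him⟩ : ∃ ν : ℂ, (ν = μ ∨ ν = μ⁻¹) ∧ 0 < ((ν - g 1 1) / g 1 0 : ℂ).im := by
    have him : ∀ ν : ℂ, ((ν - g 1 1) / g 1 0 : ℂ).im = ν.im / g 1 0 := by
      intro ν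
      rw [Complex.div_ofReal_im]
      simp
    have hinv : (μ⁻¹).im = -μ.im := by
      rw [Complex.inv_eq_conj hμ0, Complex.conj_im]
    rcases lt_or_gt_of_ne (div_ne_zero hμ hc) with h | h
    · refine ⟨μ⁻¹, Or.inr rfl, ?_⟩
      rw [him, hinv, neg_div]
      linarith
    · exact ⟨μ, Or.inl rfl, by rwa [him]⟩
  refine ⟨⟨_, him⟩, ν, hν, ?_, ?_⟩
  · change (g 0 0 * ((ν - g 1 1) / g 1 0) + g 0 1 : ℂ) = ν * ((ν - g 1 1) / g 1 0)
    field_simp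
    linear_combination -(hroot ν hν) - hd
  · change (g 1 0 * ((ν - g 1 1) / g 1 0) + g 1 1 : ℂ) = ν
    field_simp
    ring

/-- The pairwise transversality of the eigenvectors of a real elliptic matrix and its translates by
a matrix that moves its fixed point in the upper half-plane. -/
theorem planeDet_ne_zero_of_smul_ne {h : SL(2, ℝ)} {z : UpperHalfPlane} (hz : h • z ≠ z) :
    let hC : Matrix (Fin 2) (Fin 2) ℂ := Matrix.SpecialLinearGroup.map (n := Fin 2) Complex.ofRealHom h
    let u : Fin 2 → ℂ := ![z, 1]
    let v : Fin 2 → ℂ := ![(starRingEnd ℂ) z, 1]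
    planeDet u v ≠ 0 ∧ planeDet u (hC.mulVec u) ≠ 0 ∧ planeDet u (hC.mulVec v) ≠ 0 ∧
      planeDet v (hC.mulVec u) ≠ 0 ∧ planeDet v (hC.mulVec v) ≠ 0 := by
  intro hC u v
  have hden : (h 1 0 * z + h 1 1 : ℂ) ≠ 0 := by
    intro h0
    have him := congrArg Complex.im h0
    simp [z.im_ne_zero] at him
    have hre := congrArg Complex.re h0
    have hd := h.det_coe
    simp [him] at hre
    rw [Matrix.det_fin_two, him, hre] at hd
    simp at hd
  have hcoe : ((h • z : UpperHalfPlane) : ℂ) * (h 1 0 * z + h 1 1) = h 0 0 * z + h 0 1 := by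
    rw [UpperHalfPlane.coe_specialLinearGroup_apply]
    exact div_mul_cancel₀ _ hden
  have e1 : planeDet u (hC.mulVec u) = (z - (h • z : UpperHalfPlane)) * (h 1 0 * z + h 1 1) := by
    rw [sub_mul, hcoe]
    simp [planeDet, u, hC, Matrix.mulVec, dotProduct, Fin.sum_univ_two]
  have e2 : planeDet v (hC.mulVec u) =
      ((starRingEnd ℂ) z - (h • z : UpperHalfPlane)) * (h 1 0 * z + h 1 1) := by
    rw [sub_mul, hcoe]
    simp [planeDet, u, v, hC, Matrix.mulVec, dotProduct, Fin.sum_univ_two]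
  have e3 : planeDet v (hC.mulVec v) = (starRingEnd ℂ) (planeDet u (hC.mulVec u)) := by
    simp [planeDet, u, v, hC, Matrix.mulVec, dotProduct, Fin.sum_univ_two]
  have e4 : planeDet u (hC.mulVec v) = (starRingEnd ℂ) (planeDet v (hC.mulVec u)) := by
    simp [planeDet, u, v, hC, Matrix.mulVec, dotProduct, Fin.sum_univ_two]
  have n1 : planeDet u (hC.mulVec u) ≠ 0 := by
    rw [e1]
    refine mul_ne_zero (sub_ne_zero.2 fun h0 => hz ?_) hden
    exact UpperHalfPlane.ext h0.symm
  -- The conjugate of `z` lies in the lower half-plane, while `h • z` stays in the upper one.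
  have n2 : planeDet v (hC.mulVec u) ≠ 0 := by
    rw [e2]
    refine mul_ne_zero (sub_ne_zero.2 fun h0 => ?_) hden
    have him := congrArg Complex.im h0
    rw [Complex.conj_im] at him
    have h1 : 0 < (z : ℂ).im := z.im_pos
    have h2 : 0 < ((h • z : UpperHalfPlane) : ℂ).im := (h • z).im_pos
    linarith
  refine ⟨?_, n1, ?_, n2, ?_⟩
  · intro h0
    have him := congrArg Complex.im h0
    simp [planeDet, u, v] at him
    exact z.im_ne_zero him
  · rw [e4]
    exact (map_ne_zero _).2 n2
  · rw [e3]
    exact (map_ne_zero _).2 n1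

theorem map_planeDet {K L : Type*} [Field K] [Field L] (σ : K →+* L) (u v : Fin 2 → K) :
    planeDet (σ ∘ u) (σ ∘ v) = σ (planeDet u v) := by
  simp [planeDet]

theorem map_mulVec_eq {K L : Type*} [Field K] [Field L] (σ : K →+* L) (g : SL(2, K))
    (u : Fin 2 → K) :
    (Matrix.SpecialLinearGroup.map (n := Fin 2) σ g : Matrix (Fin 2) (Fin 2) L).mulVec (σ ∘ u) =
      σ ∘ ((g : Matrix (Fin 2) (Fin 2) K).mulVec u) := by
  ext i
  fin_cases i <;> simp [Matrix.mulVec, dotProduct, Fin.sum_univ_two]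

theorem proposition5p16 (H : Subgroup PSL(2, ℝ)) (hfg : H.FG)
    (hne : ¬ IsElementarySubgroup H) (hnd : ¬ DiscreteTopology H) :
    ∃ α ∈ H, IsEllipticPSL α ∧ ¬ IsOfFinOrder α ∧
      ∃ h ∈ H, ∀ U ∈ 𝓝 (1 : PSL(2, ℝ)),
        ∃ p q : ℕ, 0 < p ∧ 0 < q ∧
          α ^ p ∈ U ∧ (h * α * h⁻¹) ^ q ∈ U ∧
          FreelyGenerate (α ^ p) ((h * α * h⁻¹) ^ q) := by
  obtain ⟨_, hαH, ⟨g, rfl, hgell⟩, hinf⟩ := exists_isEllipticPSL_not_isOfFinOrder hfg hne hnd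
  have hg := trace_sq_lt_of_isElliptic hgell
  refine ⟨g, hαH, isEllipticPSL_mk hg, hinf, ?_⟩
  obtain ⟨φ, μ, hφ, hμ1, hμim, htr⟩ := exists_complex_algHom_of_trace_lt hg
  have hroot : ∀ n : ℕ, 0 < n → μ ^ n ≠ 1 := by
    intro n hn h
    refine hinf (isOfFinOrder_iff_pow_eq_one.2 ⟨n, hn, ?_⟩)
    have h1 : g ^ n = 1 := by
      apply Subtype.ext
      change ((g ^ n : SL(2, ℝ)) : Matrix (Fin 2) (Fin 2) ℝ) = (1 : SL(2, ℝ))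
      rw [Matrix.SpecialLinearGroup.coe_pow, ← hφ, ← map_pow, h, map_one,
        Matrix.SpecialLinearGroup.coe_one]
    rw [← QuotientGroup.mk_pow, h1, QuotientGroup.mk_one]
  -- The field `k`, the element `h` and the threshold `N` below do not depend on `U`; only the
  -- exponents do.
  obtain ⟨k, hk, σ, hσ⟩ := exists_ringHom_norm_ne_one hroot
  obtain ⟨z, ν, hν, hz0, hz1⟩ := exists_upperHalfPlane_eigenvector hμ1 hμim htr
  have hσν : ‖σ ν‖ ≠ 1 := by
    rcases hν with rfl | rfl
    · exact hσ
    · rwa [map_inv₀, norm_inv, Ne, inv_eq_one]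
  have hν1 : ‖ν‖ = 1 := by
    rcases hν with rfl | rfl
    · exact hμ1
    · rw [norm_inv, hμ1, inv_one]
  have hνinv : ν⁻¹ = (starRingEnd ℂ) ν := Complex.inv_eq_conj hν1
  obtain ⟨h, hh, hhz⟩ : ∃ h ∈ slPreimage H, h • z ≠ z := by
    by_contra! hcon
    exact hne (Or.inl ⟨z, forall_mem_of_slPreimage fun g hg => hcon g hg⟩)
  refine ⟨h, mem_slPreimage.1 hh, fun U hU => ?_⟩
  let f := Matrix.SpecialLinearGroup.map (n := Fin 2) Complex.ofRealHom
  let f' := Matrix.SpecialLinearGroup.map (n := Fin 2) (σ.comp Complex.ofRealHom)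
  have hf' : ∀ (a : SL(2, ℝ)) (u : Fin 2 → ℂ), (f' a : Matrix (Fin 2) (Fin 2) k).mulVec (σ ∘ u) =
      σ ∘ ((f a : Matrix (Fin 2) (Fin 2) ℂ).mulVec u) := fun a u => map_mulVec_eq σ (f a) u
  let u : Fin 2 → ℂ := ![z, 1]
  let v : Fin 2 → ℂ := ![(starRingEnd ℂ) z, 1]
  obtain ⟨duv, duw, duy, dvw, dvy⟩ := planeDet_ne_zero_of_smul_ne hhz
  have hu : (f g : Matrix (Fin 2) (Fin 2) ℂ).mulVec u = ν • u := by
    ext i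
    fin_cases i
    · simpa [Matrix.mulVec, dotProduct, Fin.sum_univ_two, f, u] using hz0
    · simpa [Matrix.mulVec, dotProduct, Fin.sum_univ_two, f, u] using hz1
  have hv : (f g : Matrix (Fin 2) (Fin 2) ℂ).mulVec v = ν⁻¹ • v := by
    rw [hνinv]
    ext i
    fin_cases i
    · simpa [Matrix.mulVec, dotProduct, Fin.sum_univ_two, f, v] using congrArg (starRingEnd ℂ) hz0
    · simpa [Matrix.mulVec, dotProduct, Fin.sum_univ_two, f, v] using congrArg (starRingEnd ℂ) hz1
  have hconj : ∀ (x : Fin 2 → ℂ) (c : ℂ), (f g : Matrix (Fin 2) (Fin 2) ℂ).mulVec x = c • x →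
      (f (h * g * h⁻¹) : Matrix (Fin 2) (Fin 2) ℂ).mulVec
        ((f h : Matrix (Fin 2) (Fin 2) ℂ).mulVec x) =
          c • (f h : Matrix (Fin 2) (Fin 2) ℂ).mulVec x := by
    intro x c hx
    rw [Matrix.mulVec_mulVec, ← Matrix.SpecialLinearGroup.coe_mul, ← map_mul,
      inv_mul_cancel_right, map_mul, Matrix.SpecialLinearGroup.coe_mul, ← Matrix.mulVec_mulVec, hx,
      Matrix.mulVec_smul]
  have hpush : ∀ (a : SL(2, ℝ)) (x : Fin 2 → ℂ) (c : ℂ),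
      (f a : Matrix (Fin 2) (Fin 2) ℂ).mulVec x = c • x →
      (f' a : Matrix (Fin 2) (Fin 2) k).mulVec (σ ∘ x) = σ c • (σ ∘ x) := by
    intro a x c hx
    rw [hf', hx]
    ext i
    simp
  have hdet : ∀ {x y : Fin 2 → ℂ}, planeDet x y ≠ 0 → planeDet (σ ∘ x) (σ ∘ y) ≠ 0 := by
    intro x y hxy
    rw [map_planeDet]
    exact (map_ne_zero σ).2 hxy
  have hinv := map_inv₀ σ ν
  obtain ⟨N, hN⟩ := eventually_injective_lift_pow_of_norm_ne_one (A := f' g)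
    (B := f' (h * g * h⁻¹)) hσν (hpush g u ν hu) (hinv ▸ hpush g v _ hv)
    (hpush _ _ _ (hconj u ν hu)) (hinv ▸ hpush _ _ _ (hconj v _ hv))
    (hdet duv) (hdet (by rw [planeDet_mulVec]; exact duv)) (hdet duw) (hdet duy) (hdet dvw)
    (hdet dvy)
  -- Using `N + 1` rather than `N` makes the exponent positive as well.
  obtain ⟨p, hp, hpU⟩ := (frequently_atTop.1 (frequently_pow_mem_nhds_one hg hU)) (N + 1)
  have hgc : ((h * g * h⁻¹ : SL(2, ℝ)) : Matrix (Fin 2) (Fin 2) ℝ).trace ^ 2 < 4 := by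
    rwa [trace_conj_eq]
  obtain ⟨q, hq, hqU⟩ := (frequently_atTop.1 (frequently_pow_mem_nhds_one hgc hU)) (N + 1)
  refine ⟨p, q, by omega, by omega, hpU, hqU, ?_⟩
  refine freelyGenerate_of_injective_map (σ.comp Complex.ofRealHom) (a := g ^ p)
    (b := (h * g * h⁻¹) ^ q) ?_
  have := hN p q (by omega) (by omega)
  rw [← map_pow, ← map_pow] at this
  exact this

end Conclusion
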